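/- **Lower bound.** Let $d\ge 1$ and let $\mathbb T^d$ be the torus with coordinates in $[0,2\pi)^d$ and Lebesgue measure $\rho(d\theta)=\prod_i d\theta_i$; let $S_\ell(\theta)=(2\pi)^{-d/2}e^{i\langle \ell,\theta\rangle}$ and $\varepsilon_\ell=(\sum_i\ell_i^2)^{1/2}$ for $\ell\in\mathbb Z^d$. Fix a system of toroidal needlets, that is: a scale $B>1$; a window $b\in C^\infty(\mathbb R)$, $b\ge 0$, supported in $[B^{-1},B]$, with $\sum_{j\ge 0}b^2(c/B^j)=1$ for all $c>1$; and, for each $j\ge 0$, points $\xi_{j,k}\in\mathbb T^d$ and weights $\lambda_{j,k}>0$ ($1\le k\le K_j$), with $\lambda_{j,k}\approx B^{-jd}$ uniformly in $j,k$, such that $\sum_k\lambda_{j,k}S_\ell(\xi_{j,k})\overline{S_{\ell'}(\xi_{j,k})}=\int S_\ell\overline{S_{\ell'}}\,d\rho$ whenever $\varepsilon_\ell,\varepsilon_{\ell'}\le B^{j+1}$. Put $$\psi_{j,k}(\theta)=\sqrt{\lambda_{j,k}}\sum_{\ell\in\mathbb Z^d}b(\varepsilon_\ell/B^j)\,\overline{S_\ell(\xi_{j,k})}\,S_\ell(\theta),\qquad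 \beta_{j,k}(f)=\int f\,\overline{\psi_{j,k}}\,d\rho,$$ $$\|f\|_{\mathcal B^{t}_{r,q}}=\Big\|\Big(B^{j[t+d(\frac12-\frac1r)]}\,\big\|(\beta_{j,k}(f))_{k}\big\|_{\ell^r}\Big)_{j\ge 0}\Big\|_{\ell^q}.$$ Let $m\in\mathbb N_0^d$, $1\le r\le\infty$, $0<q\le\infty$, $1\le p\le\infty$, $s>d/r$ and $G>0$, and let $\mathcal B^{s+|m|}_{r,q}(G)$ be the set of probability densities $f\in C^{|m|}(\mathbb T^d)$ with respect to $\rho$ such that $\|f\|_{\mathcal B^{s+|m|}_{r,q}}\le G$. Write $f^{(m)}=D^mf$. Then there is a constant $c>0$, depending only on the needlet system and on $d,m,s,r,q,p,G$, such that for every $n\ge 1$ and every estimator $\hat f^{(m)}$ of $f^{(m)}$, that is, every real-valued function of the sample and of $\theta\in\mathbb T^d$ that is jointly measurable, based on $n$ independent observations with density $f$, $$\sup_{f\in\mathcal B^{s+|m|}_{r,q}(G)}\mathbb E\Big[\big\|\hat f^{(m)}-f^{(m)}\big\|_{L^p(\mathbb T^d)}^p\Big]\ \ge\ c\,n^{-\alpha(s,|m|,p,r)}\quad(1\le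 p<\infty),$$ $$\sup_{f\in\mathcal B^{s+|m|}_{r,q}(G)}\mathbb E\Big[\big\|\hat f^{(m)}-f^{(m)}\big\|_{L^\infty(\mathbb T^d)}\Big]\ \ge\ c\,n^{-\alpha(s,|m|,\infty,r)}\quad(p=\infty),$$ where for $p<\infty$ $$\alpha(s,|m|,p,r)=\begin{cases}\dfrac{ps}{2(s+|m|)+d}&\text{if } r\ge\dfrac{(2|m|+d)p}{2(s+|m|)+d}\quad\text{(regular zone)},\\[2ex]\dfrac{p\big(s+d(\frac1p-\frac1r)\big)}{2\big[(s+|m|)+d(\frac12-\frac1r)\big]}&\text{if } r<\dfrac{(2|m|+d)p}{2(s+|m|)+d}\quad\text{(sparse zone)},\end{cases}$$ and $$\alpha(s,|m|,\infty,r)=\frac{s-\frac dr}{2\big[(s+|m|)-d(\frac1r-\frac12)\big]}.$$ -/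

import Mathlib

open MeasureTheory
open scoped ENNReal ContDiff ComplexConjugate

noncomputable section

namespace TorusNeedlet

/-! Functions on the torus `𝕋^d` are represented by functions on `ℝ^d = Fin d → ℝ` that are
`2π`-periodic in each coordinate; integrals and `L^p` norms are taken over `[0, 2π)^d`. -/

/-- The fundamental domain `[0, 2π)^d` of the `d`-dimensional torus. -/
def cube (d : ℕ) : Set (Fin d → ℝ) :=
  Set.univ.pi fun _ => Set.Ico 0 (2 * Real.pi)

/-- The (unnormalised) Lebesgue measure `ρ(dθ) = ∏ dθ_i` of the torus, on `[0, 2π)^d`. -/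
def rho (d : ℕ) : Measure (Fin d → ℝ) :=
  volume.restrict (cube d)

/-- `f` is `2π`-periodic in each coordinate, that is, a function on the torus. -/
def IsPeriodic {d : ℕ} (f : (Fin d → ℝ) → ℝ) : Prop :=
  ∀ i : Fin d, Function.Periodic f (Pi.single i (2 * Real.pi))

/-! ### Derivatives -/

/-- The partial derivative `∂f/∂θ_i`. -/
def partialDeriv {d : ℕ} (i : Fin d) (f : (Fin d → ℝ) → ℝ) : (Fin d → ℝ) → ℝ :=
  fun θ => fderiv ℝ f θ (Pi.single i 1)

/-- The length `|m| = m_1 + ⋯ + m_d` of a multi-index. -/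
def order {d : ℕ} (m : Fin d → ℕ) : ℕ := ∑ i, m i

/-- `D^m f = ∂^{|m|} f / ∂θ_1^{m_1} ⋯ ∂θ_d^{m_d}`. -/
def multiDeriv {d : ℕ} (m : Fin d → ℕ) (f : (Fin d → ℝ) → ℝ) : (Fin d → ℝ) → ℝ :=
  (List.finRange d).foldr (fun i g => (partialDeriv i)^[m i] g) f

/-! ### Toroidal needlets -/

/-- The orthonormal Fourier basis `S_ℓ(θ) = (2π)^{-d/2} exp(i⟨ℓ, θ⟩)`. -/
def fourierS {d : ℕ} (l : Fin d → ℤ) (θ : Fin d → ℝ) : ℂ :=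
  (((2 * Real.pi) ^ (-(d : ℝ) / 2) : ℝ) : ℂ) *
    Complex.exp (Complex.I * ((∑ i, (l i : ℝ) * θ i : ℝ) : ℂ))

/-- The Euclidean length `ε_ℓ` of a frequency; `S_ℓ` has Laplace eigenvalue `-ε_ℓ²`. -/
def freqNorm {d : ℕ} (l : Fin d → ℤ) : ℝ :=
  Real.sqrt (∑ i, (l i : ℝ) ^ 2)

/-- The data of a system of toroidal needlets: a scale `B > 1`, a smooth window `b` with support
in `[B⁻¹, B]` and the partition of unity property, and, at every resolution level `j`, finitely
many cubature points `ξ_{j,k}` with positive weights `λ_{j,k}` of order `B^{-jd}` whose cubature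
formula is exact for products of two trigonometric polynomials of degree at most `B^{j+1}`. -/
structure NeedletSystem (d : ℕ) where
  /-- the scale parameter -/
  B : ℝ
  one_lt_B : 1 < B
  /-- the needlet window function -/
  b : ℝ → ℝ
  b_nonneg : ∀ c, 0 ≤ b c
  b_support : ∀ c, c ∉ Set.Icc B⁻¹ B → b c = 0
  b_smooth : ContDiff ℝ ∞ b
  b_partition : ∀ c : ℝ, 1 < c → HasSum (fun j : ℕ => b (c / B ^ j) ^ 2) 1
  /-- the number of cubature points at level `j` -/
  K : ℕ → ℕ
  /-- the cubature points -/
  ξ : (j : ℕ) → Fin (K j) → (Fin d → ℝ)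
  ξ_mem : ∀ j k, ξ j k ∈ cube d
  /-- the cubature weights -/
  lam : (j : ℕ) → Fin (K j) → ℝ
  lam_pos : ∀ j k, 0 < lam j k
  lam_size : ∃ c C : ℝ, 0 < c ∧ ∀ (j : ℕ) (k : Fin (K j)),
    c * B ^ (-((j : ℝ) * d)) ≤ lam j k ∧ lam j k ≤ C * B ^ (-((j : ℝ) * d))
  cubature : ∀ (j : ℕ) (l l' : Fin d → ℤ),
    freqNorm l ≤ B ^ (j + 1) → freqNorm l' ≤ B ^ (j + 1) →
      ∑ k, (lam j k : ℂ) * (fourierS l (ξ j k) * conj (fourierS l' (ξ j k))) =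
        ∫ θ, fourierS l θ * conj (fourierS l' θ) ∂(rho d)

namespace NeedletSystem

variable {d : ℕ}

/-- The needlet
`ψ_{j,k}(θ) = √λ_{j,k} ∑_{ℓ ∈ ℤ^d} b(ε_ℓ / B^j) conj(S_ℓ(ξ_{j,k})) S_ℓ(θ)`
(only finitely many terms are non-zero). -/
def needlet (N : NeedletSystem d) (j : ℕ) (k : Fin (N.K j)) (θ : Fin d → ℝ) : ℂ :=
  (Real.sqrt (N.lam j k) : ℂ) *
    ∑' l : Fin d → ℤ, (N.b (freqNorm l / N.B ^ j) : ℂ) *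
      (conj (fourierS l (N.ξ j k)) * fourierS l θ)

/-- The needlet coefficient `β_{j,k} = ∫ f conj(ψ_{j,k}) dρ`. -/
def coeff (N : NeedletSystem d) (f : (Fin d → ℝ) → ℝ) (j : ℕ) (k : Fin (N.K j)) : ℂ :=
  ∫ θ, (f θ : ℂ) * conj (N.needlet j k θ) ∂(rho d)

/-- The Besov norm
`‖ ( B^{j (t + d (1/2 - 1/r))} ‖(β_{j,k})_k‖_{ℓ^r} )_{j ≥ 0} ‖_{ℓ^q}`,
with values in `[0, ∞]`. The `ℓ^r` and `ℓ^q` norms are `L^r` and `L^q` norms for the counting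
measure. Constants have norm zero, because the needlets have mean zero. -/
def besovNorm (N : NeedletSystem d) (t : ℝ) (r q : ℝ≥0∞) (f : (Fin d → ℝ) → ℝ) : ℝ≥0∞ :=
  eLpNorm (fun j : ℕ =>
    ENNReal.ofReal (N.B ^ ((j : ℝ) * (t + d * (1 / 2 - (r⁻¹).toReal)))) *
      eLpNorm (fun k : Fin (N.K j) => N.coeff f j k) r Measure.count) q Measure.count

/-- The probability densities on the torus of class `C^{|m|}` in the Besov ball of radius `G`
of smoothness `s + |m|`. -/
def densityBall (N : NeedletSystem d) (m : Fin d → ℕ) (s : ℝ) (r q : ℝ≥0∞) (G : ℝ) :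
    Set ((Fin d → ℝ) → ℝ) :=
  {f | IsPeriodic f ∧ ContDiff ℝ (order m) f ∧ (∀ θ, 0 ≤ f θ) ∧ ∫ θ, f θ ∂(rho d) = 1 ∧
    N.besovNorm (s + order m) r q f ≤ ENNReal.ofReal G}

end NeedletSystem

/-! ### The statistical experiment -/

/-- The joint law of `n` independent observations with density `f` on the torus. -/
def sampleLaw {d : ℕ} (n : ℕ) (f : (Fin d → ℝ) → ℝ) : Measure (Fin n → (Fin d → ℝ)) :=
  Measure.pi fun _ => (rho d).withDensity fun θ => ENNReal.ofReal (f θ)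

/-- An estimator based on `n` observations: it sends the sample to a function on the torus, and
is jointly measurable in the sample and the point. -/
structure Estimator (d n : ℕ) where
  /-- the estimate at a point, given the sample -/
  toFun : (Fin n → (Fin d → ℝ)) → (Fin d → ℝ) → ℝ
  measurable_toFun : Measurable (Function.uncurry toFun)

/-- The `L^p` risk `E ‖f̂ - f^{(m)}‖_{L^p}^p` for `p < ∞`, and `E ‖f̂ - f^{(m)}‖_{L^∞}` for
`p = ∞`, under independent observations with density `f`. -/
def risk {d n : ℕ} (m : Fin d → ℕ) (p : ℝ≥0∞) (fhat : Estimator d n)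
    (f : (Fin d → ℝ) → ℝ) : ℝ≥0∞ :=
  ∫⁻ x, eLpNorm (fun θ => fhat.toFun x θ - multiDeriv m f θ) p (rho d) ^
    (if p = ⊤ then 1 else p.toReal : ℝ) ∂(sampleLaw n f)

/-- The exponent `α(s, |m|, p, r)`: for `p < ∞` the regular zone is
`r ≥ (2|m| + d) p / (2 (s + |m|) + d)`, and the sparse zone its complement. -/
def rateExponent (d : ℕ) (s : ℝ) (M : ℕ) (p r : ℝ≥0∞) : ℝ :=
  if p = ⊤ then
    (s - d * (r⁻¹).toReal) / (2 * ((s + M) - d * ((r⁻¹).toReal - 1 / 2)))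
  else if ENNReal.ofReal ((2 * M + d) * p.toReal / (2 * (s + M) + d)) ≤ r then
    p.toReal * s / (2 * (s + M) + d)
  else
    p.toReal * (s + d * (1 / p.toReal - (r⁻¹).toReal)) /
      (2 * ((s + M) + d * (1 / 2 - (r⁻¹).toReal)))

end TorusNeedlet

end

/-!
The lower bound comes from perturbing the uniform density `(2π)^{-d}` by wave packets of frequency
`R`. Let `P` be the Dirichlet kernel of the block `[R, 2R)^d` of frequencies; a packet is
`γ Re((-i)^{|m|} P(θ - x_τ)²)`, where `x_τ` runs through the regular grid with `R^d` points. Squares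
of Dirichlet kernels are convenient for three reasons.

* The functions `|P(· - x_τ)|²` add up to the constant `R^{2d}` (`sum_sq_norm_blockSum_grid`), so an
  arbitrary superposition of packets with weights in `[-1, 1]` is bounded by `A = γ R^{2d}`, the size
  of a single one.
* All frequencies of `P²` dominate those of `P`. At every level `j` that sees the packet the
  cubature formula is therefore exact for `|P|²` and its translates, which bounds the weighted `ℓ¹`
  norm of the samples of a single packet (`sum_lam_mul_sq_norm_blockSum`).
* The phase makes the `m`-th derivative at `θ` of the packet centred at `x_τ` a sum of terms
  `l^m cos⟨l, θ - x_τ⟩` over frequencies `l ∈ [2R, 4R)^d`; it is at least of order `A R^{|m|}` on a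
  cell of side of order `1/R` at `x_τ` (`le_multiDeriv_sub_multiDeriv`).

The needlet coefficients at level `j` are samples, at the cubature points, of the function filtered
by the Fourier multiplier `b(|·| / B^j)` (`coeff_re_trigSum`). As `x ↦ b(‖x‖)` is a Schwartz
function, Fourier inversion writes this filter as an average of translations against a fixed
integrable density (`exists_integrable_kernel`), so no localisation of the needlets is needed:
translation-invariant bounds pass to the filtered function. Interpolation between `ℓ¹` and `ℓ^∞`,
and the fact that only boundedly many levels see the frequencies of size `R`, bound the Besov norm
in smoothness `t = s + |m|` by a multiple of `R^t A W^{1/r}` (`exists_besovNorm_le`), where `W` is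
constant for a superposition of packets and of order `R^{-d}` for a single packet.

On the statistical side, `n` observations do not distinguish two such densities that differ in one
packet as long as `n A² R^{-d}` is small (`le_localRisk_packetDensity`, by the Hellinger affinity).
With a single packet and `A` of order `R^{-(s+|m|-d/r)}` the two-point method gives the rate of the
sparse zone and of `p = ∞`; with the full hypercube of signs and `A` of order `R^{-(s+|m|)}`,
averaging over its edges (`card_mul_le_of_edges`) gives the rate of the regular zone. Both bounds hold
for all values of the parameters, so the distinction of zones plays no role in the proof.
-/

noncomputable section

namespace TorusNeedlet

section

variable {d : ℕ}

/-! ### Characters of the torus -/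

/-- The unnormalised character `θ ↦ exp(i⟨l, θ⟩)`. -/
def expChar (l : Fin d → ℤ) (θ : Fin d → ℝ) : ℂ :=
  Complex.exp (Complex.I * ((∑ i, (l i : ℝ) * θ i : ℝ) : ℂ))

lemma fourierS_eq (l : Fin d → ℤ) (θ : Fin d → ℝ) :
    fourierS l θ = (((2 * Real.pi) ^ (-(d : ℝ) / 2) : ℝ) : ℂ) * expChar l θ := rfl

lemma expChar_eq_prod (l : Fin d → ℤ) (θ : Fin d → ℝ) :
    expChar l θ = ∏ i, Complex.exp (Complex.I * ((l i : ℝ) * θ i : ℝ)) := by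
  rw [expChar, ← Complex.exp_sum]
  congr 1
  push_cast
  rw [Finset.mul_sum]

lemma expChar_zero (θ : Fin d → ℝ) : expChar (0 : Fin d → ℤ) θ = 1 := by
  simp [expChar]

lemma expChar_add_right (l : Fin d → ℤ) (x y : Fin d → ℝ) :
    expChar l (x + y) = expChar l x * expChar l y := by
  simp only [expChar, ← Complex.exp_add, Pi.add_apply, mul_add, Finset.sum_add_distrib]
  push_cast
  rw [mul_add]

lemma expChar_add_left (l l' : Fin d → ℤ) (x : Fin d → ℝ) :
    expChar (l + l') x = expChar l x * expChar l' x := by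
  simp only [expChar, ← Complex.exp_add, Pi.add_apply]
  push_cast
  rw [← mul_add, ← Finset.sum_add_distrib]
  simp only [add_mul]

lemma expChar_neg_left (l : Fin d → ℤ) (x : Fin d → ℝ) :
    expChar (-l) x = conj (expChar l x) := by
  simp only [expChar, ← Complex.exp_conj, Pi.neg_apply, map_mul, Complex.conj_I,
    Complex.conj_ofReal]
  push_cast
  simp

lemma expChar_neg_right (l : Fin d → ℤ) (x : Fin d → ℝ) :
    expChar l (-x) = expChar (-l) x := by
  simp [expChar]

lemma norm_expChar (l : Fin d → ℤ) (x : Fin d → ℝ) : ‖expChar l x‖ = 1 := by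
  rw [expChar, mul_comm, Complex.norm_exp_ofReal_mul_I]

lemma expChar_re (l : Fin d → ℤ) (x : Fin d → ℝ) :
    (expChar l x).re = Real.cos (∑ i, (l i : ℝ) * x i) := by
  rw [expChar, mul_comm, Complex.exp_ofReal_mul_I_re]

lemma contDiff_expChar (l : Fin d → ℤ) {n : WithTop ℕ∞} : ContDiff ℝ n (expChar l) := by
  have h : ContDiff ℝ n fun θ : Fin d → ℝ => ∑ i, (l i : ℝ) * θ i := by fun_prop
  exact (contDiff_const.mul (Complex.ofRealCLM.contDiff.comp h)).cexp

lemma continuous_expChar (l : Fin d → ℤ) : Continuous (expChar l) :=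
  (contDiff_expChar l (n := 0)).continuous

instance isFiniteMeasure_rho : IsFiniteMeasure (rho d) := by
  refine ⟨?_⟩
  rw [rho, Measure.restrict_apply_univ, cube, volume_pi_pi]
  exact ENNReal.prod_lt_top fun i _ => by rw [Real.volume_Ico]; exact ENNReal.ofReal_lt_top

lemma rho_eq_pi :
    rho d = Measure.pi fun _ => (volume : Measure ℝ).restrict (Set.Ico 0 (2 * Real.pi)) := by
  rw [rho, cube, volume_pi, Measure.restrict_pi_pi]

lemma rho_univ : rho d Set.univ = ENNReal.ofReal ((2 * Real.pi) ^ d) := by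
  rw [rho, Measure.restrict_apply_univ, cube, volume_pi_pi]
  simp [ENNReal.ofReal_pow Real.two_pi_pos.le]

lemma integrable_of_continuous_bounded {E : Type*} [NormedAddCommGroup E]
    [SecondCountableTopologyEither (Fin d → ℝ) E] {f : (Fin d → ℝ) → E}
    (hf : Continuous f) {C : ℝ} (hC : ∀ x, ‖f x‖ ≤ C) : Integrable f (rho d) :=
  Integrable.of_bound hf.aestronglyMeasurable C (.of_forall hC)

lemma integral_exp_Ico (l : ℤ) :
    ∫ t in Set.Ico 0 (2 * Real.pi), Complex.exp (Complex.I * ((l : ℝ) * t : ℝ)) =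
      if l = 0 then ((2 * Real.pi : ℝ) : ℂ) else 0 := by
  rw [integral_Ico_eq_integral_Ioc, ← intervalIntegral.integral_of_le Real.two_pi_pos.le]
  split_ifs with h
  · simp [h]
  · have hl : Complex.I * (l : ℂ) ≠ 0 := mul_ne_zero Complex.I_ne_zero (by exact_mod_cast h)
    have h1 := integral_exp_mul_complex (a := 0) (b := 2 * Real.pi) hl
    have h2 : ∀ t : ℝ, Complex.exp (Complex.I * ((l : ℝ) * t : ℝ)) =
        Complex.exp (Complex.I * l * t) := fun t => by push_cast; ring_nf
    simp only [h2]
    rw [h1]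
    have h3 : Complex.exp (Complex.I * l * ((2 * Real.pi : ℝ) : ℂ)) = 1 := by
      rw [Complex.exp_eq_one_iff]
      exact ⟨l, by push_cast; ring⟩
    rw [h3]
    simp

lemma integral_expChar (l : Fin d → ℤ) :
    ∫ θ, expChar l θ ∂(rho d) = if l = 0 then (((2 * Real.pi) ^ d : ℝ) : ℂ) else 0 := by
  simp only [expChar_eq_prod]
  rw [rho_eq_pi, integral_fintype_prod_eq_prod
    (f := fun i (t : ℝ) => Complex.exp (Complex.I * ((l i : ℝ) * t : ℝ)))]
  simp only [integral_exp_Ico]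
  split_ifs with h
  · simp [h]
  · obtain ⟨i, hi⟩ := Function.ne_iff.mp h
    exact Finset.prod_eq_zero (Finset.mem_univ i) (if_neg hi)

lemma expChar_mul_conj (l l' : Fin d → ℤ) (x : Fin d → ℝ) :
    expChar l x * conj (expChar l' x) = expChar (l - l') x := by
  rw [← expChar_neg_left, ← expChar_add_left, sub_eq_add_neg]

lemma integral_expChar_mul_conj (l l' : Fin d → ℤ) :
    ∫ θ, expChar l θ * conj (expChar l' θ) ∂(rho d) =
      if l = l' then (((2 * Real.pi) ^ d : ℝ) : ℂ) else 0 := by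
  simp only [expChar_mul_conj, integral_expChar, sub_eq_zero]

/-- Discrete orthogonality of the characters on the regular grid with `R ^ d` points. -/
lemma sum_expChar_grid {R : ℕ} {l : Fin d → ℤ} (hl : ∀ i, |l i| < R) :
    ∑ τ : Fin d → Fin R, expChar l (fun i => 2 * Real.pi * (τ i : ℝ) / R) =
      if l = 0 then ((R : ℂ)) ^ d else 0 := by
  have h1 : ∀ a : ℤ, |a| < R → ∑ t : Fin R,
      Complex.exp (Complex.I * ((a : ℝ) * (2 * Real.pi * (t : ℝ) / R) : ℝ)) =
        if a = 0 then (R : ℂ) else 0 := by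
    intro a ha
    have hR : (R : ℂ) ≠ 0 := by
      have : 0 < R := by
        have := (abs_nonneg a).trans_lt ha
        exact_mod_cast this
      exact_mod_cast this.ne'
    split_ifs with h0
    · simp [h0]
    set ζ : ℂ := Complex.exp (2 * Real.pi * Complex.I * (a / R)) with hζ
    have hterm : ∀ t : Fin R,
        Complex.exp (Complex.I * ((a : ℝ) * (2 * Real.pi * (t : ℝ) / R) : ℝ)) = ζ ^ (t : ℕ) := by
      intro t
      rw [hζ, ← Complex.exp_nat_mul]
      congr 1
      push_cast
      ring
    simp only [hterm]
    rw [Fin.sum_univ_eq_sum_range (fun t => ζ ^ t)]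
    have hpow : ζ ^ R = 1 := by
      rw [hζ, ← Complex.exp_nat_mul, Complex.exp_eq_one_iff]
      exact ⟨a, by field_simp⟩
    have hne : ζ - 1 ≠ 0 := by
      rw [sub_ne_zero]
      intro h
      rw [hζ, Complex.exp_eq_one_iff] at h
      obtain ⟨n, hn⟩ := h
      have h2 : (a : ℂ) = n * R := by
        have hpi : (2 * Real.pi * Complex.I : ℂ) ≠ 0 := Complex.two_pi_I_ne_zero
        have h3 : (2 * Real.pi * Complex.I : ℂ) * (a / R) = (2 * Real.pi * Complex.I : ℂ) * n := by
          rw [hn]; ring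
        have := mul_left_cancel₀ hpi h3
        field_simp at this
        rw [this]; ring
      have h4 : a = n * R := by exact_mod_cast h2
      have hn0 : n ≠ 0 := by rintro rfl; simp at h4; exact h0 h4
      have h5 : (1 : ℤ) ≤ |n| := Int.one_le_abs hn0
      rw [h4, abs_mul, Nat.abs_cast] at ha
      nlinarith [(Nat.cast_nonneg R : (0 : ℤ) ≤ R)]
    have := mul_geom_sum ζ R
    rw [hpow, sub_self] at this
    exact (mul_eq_zero.mp this).resolve_left hne
  simp only [expChar_eq_prod]
  have h2 := Finset.prod_univ_sum (fun _ : Fin d => (Finset.univ : Finset (Fin R)))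
    (fun i t => Complex.exp (Complex.I * ((l i : ℝ) * (2 * Real.pi * (t : ℝ) / R) : ℝ)))
  rw [Fintype.piFinset_univ] at h2
  rw [← h2]
  simp only [h1 _ (hl _)]
  split_ifs with h
  · simp [h]
  · obtain ⟨i, hi⟩ := Function.ne_iff.mp h
    exact Finset.prod_eq_zero (Finset.mem_univ i) (if_neg hi)

/-! ### Trigonometric polynomials -/

/-- The trigonometric polynomial with frequencies `L i` and coefficients `c i`. -/
def trigSum {ι : Type*} [Fintype ι] (L : ι → Fin d → ℤ) (c : ι → ℂ) (θ : Fin d → ℝ) : ℂ :=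
  ∑ i, c i * expChar (L i) θ

section TrigSum

variable {ι : Type*} [Fintype ι] (L : ι → Fin d → ℤ) (c : ι → ℂ)

lemma contDiff_trigSum {n : WithTop ℕ∞} : ContDiff ℝ n (trigSum L c) := by
  unfold trigSum
  exact ContDiff.sum fun i _ => contDiff_const.mul (contDiff_expChar _)

lemma continuous_trigSum : Continuous (trigSum L c) :=
  (contDiff_trigSum L c (n := 0)).continuous

lemma norm_trigSum_le (θ : Fin d → ℝ) : ‖trigSum L c θ‖ ≤ ∑ i, ‖c i‖ := by
  refine (norm_sum_le _ _).trans (Finset.sum_le_sum fun i _ => ?_)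
  rw [norm_mul, norm_expChar, mul_one]

lemma trigSum_add (u θ : Fin d → ℝ) :
    trigSum L c (θ + u) = trigSum L (fun i => c i * expChar (L i) u) θ := by
  simp only [trigSum, expChar_add_right]
  exact Finset.sum_congr rfl fun i _ => by ring

lemma ofReal_sq_norm_trigSum (θ : Fin d → ℝ) :
    ((‖trigSum L c θ‖ ^ 2 : ℝ) : ℂ) =
      ∑ i, ∑ i', c i * conj (c i') * (expChar (L i) θ * conj (expChar (L i') θ)) := by
  rw [Complex.ofReal_pow, ← Complex.mul_conj', trigSum, map_sum, Finset.sum_mul_sum]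
  refine Finset.sum_congr rfl fun i _ => Finset.sum_congr rfl fun i' _ => ?_
  rw [map_mul]
  ring

variable {L}

/-- Parseval's identity for a quadrature rule for which the characters are orthogonal. -/
lemma sum_sq_norm_trigSum {κ : Type*} [Fintype κ] [DecidableEq ι] (w : κ → ℝ) (x : κ → Fin d → ℝ) (V : ℝ)
    (h : ∀ i i', ∑ k, (w k : ℂ) * (expChar (L i) (x k) * conj (expChar (L i') (x k))) =
      if i = i' then (V : ℂ) else 0) :
    ∑ k, w k * ‖trigSum L c (x k)‖ ^ 2 = V * ∑ i, ‖c i‖ ^ 2 := by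
  have key : ∑ k, (w k : ℂ) * ((‖trigSum L c (x k)‖ ^ 2 : ℝ) : ℂ) =
      ((V * ∑ i, ‖c i‖ ^ 2 : ℝ) : ℂ) := by
    calc ∑ k, (w k : ℂ) * ((‖trigSum L c (x k)‖ ^ 2 : ℝ) : ℂ)
        = ∑ i, ∑ i', c i * conj (c i') *
            ∑ k, (w k : ℂ) * (expChar (L i) (x k) * conj (expChar (L i') (x k))) := by
          simp only [ofReal_sq_norm_trigSum, Finset.mul_sum]
          rw [Finset.sum_comm]
          refine Finset.sum_congr rfl fun i _ => ?_
          rw [Finset.sum_comm]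
          exact Finset.sum_congr rfl fun i' _ => Finset.sum_congr rfl fun k _ => by ring
      _ = _ := by
          simp only [h, mul_ite, mul_zero, Finset.sum_ite_eq, Finset.mem_univ, if_true,
            Complex.mul_conj']
          push_cast
          rw [Finset.mul_sum]
          exact Finset.sum_congr rfl fun i _ => by ring
  exact_mod_cast key

/-- Parseval's identity on the torus. -/
lemma integral_sq_norm_trigSum (hL : Function.Injective L) :
    ∫ θ, ‖trigSum L c θ‖ ^ 2 ∂(rho d) = (2 * Real.pi) ^ d * ∑ i, ‖c i‖ ^ 2 := by
  classical
  have key : ∫ θ, ((‖trigSum L c θ‖ ^ 2 : ℝ) : ℂ) ∂(rho d) =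
      (((2 * Real.pi) ^ d * ∑ i, ‖c i‖ ^ 2 : ℝ) : ℂ) := by
    have hint : ∀ i i', Integrable (fun θ => c i * conj (c i') *
        (expChar (L i) θ * conj (expChar (L i') θ))) (rho d) := fun i i' => by
      simp only [expChar_mul_conj]
      exact (integrable_of_continuous_bounded (continuous_expChar _)
        (fun x => (norm_expChar _ x).le)).const_mul _
    simp only [ofReal_sq_norm_trigSum]
    rw [integral_finsetSum _ fun i _ => integrable_finsetSum _ fun i' _ => hint i i']
    calc _ = ∑ i, ∑ i', c i * conj (c i') *
            (if i = i' then (((2 * Real.pi) ^ d : ℝ) : ℂ) else 0) := by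
          refine Finset.sum_congr rfl fun i _ => ?_
          rw [integral_finsetSum _ fun i' _ => hint i i']
          refine Finset.sum_congr rfl fun i' _ => ?_
          rw [integral_const_mul, integral_expChar_mul_conj]
          simp only [hL.eq_iff]
      _ = _ := by
          simp only [mul_ite, mul_zero, Finset.sum_ite_eq, Finset.mem_univ, if_true,
            Complex.mul_conj']
          push_cast
          rw [Finset.mul_sum]
          exact Finset.sum_congr rfl fun i _ => by ring
  rw [integral_complex_ofReal] at key
  exact_mod_cast key

end TrigSum

end

section

variable {d : ℕ}

/-! ### Derivatives of trigonometric polynomials -/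

section Deriv

variable {ι : Type*} [Fintype ι] (L : ι → Fin d → ℤ) (c : ι → ℂ)

lemma expChar_smul_single (l : Fin d → ℤ) (i : Fin d) (t : ℝ) :
    expChar l (t • Pi.single i (1 : ℝ)) = Complex.exp (Complex.I * l i * t) := by
  rw [expChar]
  congr 1
  have : ∑ k, (l k : ℝ) * (t • Pi.single i (1 : ℝ) : Fin d → ℝ) k = l i * t := by
    simp [Pi.single_apply]
  rw [this]
  push_cast
  ring

lemma hasDerivAt_trigSum_line (i : Fin d) (θ : Fin d → ℝ) :
    HasDerivAt (fun t : ℝ => trigSum L c (θ + t • Pi.single i (1 : ℝ)))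
      (trigSum L (fun k => (Complex.I * L k i) * c k) θ) 0 := by
  unfold trigSum
  refine HasDerivAt.fun_sum fun k _ => ?_
  simp only [expChar_add_right, expChar_smul_single]
  have h1 : HasDerivAt (fun t : ℝ => Complex.I * (L k i : ℂ) * (t : ℂ))
      (Complex.I * (L k i : ℂ)) 0 := by
    simpa using (Complex.ofRealCLM.hasDerivAt (x := 0)).const_mul (Complex.I * (L k i : ℂ))
  have h2 := ((h1.cexp.const_mul (expChar (L k) θ)).const_mul (c k))
  convert! h2 using 1
  simp
  ring

lemma partialDeriv_re_trigSum (i : Fin d) :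
    partialDeriv i (fun θ => (trigSum L c θ).re) =
      fun θ => (trigSum L (fun k => (Complex.I * L k i) * c k) θ).re := by
  funext θ
  have hdiff : DifferentiableAt ℝ (fun θ => (trigSum L c θ).re) θ :=
    (Complex.reCLM.contDiff.comp (contDiff_trigSum L c (n := 1))).differentiable (by simp) θ
  rw [partialDeriv, ← hdiff.lineDeriv_eq_fderiv]
  have h : HasLineDerivAt ℝ (fun θ => (trigSum L c θ).re)
      (trigSum L (fun k => (Complex.I * L k i) * c k) θ).re θ (Pi.single i 1) :=
    Complex.reCLM.hasFDerivAt.comp_hasDerivAt 0 (hasDerivAt_trigSum_line L c i θ)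
  exact h.lineDeriv

lemma iterate_partialDeriv_re_trigSum (i : Fin d) (n : ℕ) :
    (partialDeriv i)^[n] (fun θ => (trigSum L c θ).re) =
      fun θ => (trigSum L (fun k => (Complex.I * L k i) ^ n * c k) θ).re := by
  induction n with
  | zero => simp
  | succ n ih =>
    rw [Function.iterate_succ_apply', ih, partialDeriv_re_trigSum]
    simp only [pow_succ', mul_assoc]

lemma multiDeriv_re_trigSum (m : Fin d → ℕ) :
    multiDeriv m (fun θ => (trigSum L c θ).re) =
      fun θ => (trigSum L (fun k => (∏ i, (Complex.I * L k i) ^ m i) * c k) θ).re := by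
  have h : ∀ l : List (Fin d),
      l.foldr (fun i g => (partialDeriv i)^[m i] g) (fun θ => (trigSum L c θ).re) =
        fun θ => (trigSum L
          (fun k => (l.map fun i => (Complex.I * L k i) ^ m i).prod * c k) θ).re := by
    intro l
    induction l with
    | nil => simp
    | cons i l ih =>
      rw [List.foldr_cons, ih, iterate_partialDeriv_re_trigSum]
      simp only [List.map_cons, List.prod_cons, mul_assoc]
  rw [multiDeriv, h]
  simp only [Fin.prod_univ_def]

/-- A constant plus the real part of a trigonometric polynomial is again the real part of a
trigonometric polynomial; the constant is put at the index `none`. -/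
lemma const_add_re_trigSum (C : ℝ) :
    (fun θ => C + (trigSum L c θ).re) =
      fun θ => (trigSum (fun o : Option ι => o.elim 0 L) (fun o => o.elim (C : ℂ) c) θ).re := by
  funext θ
  simp [trigSum, Fintype.sum_option, expChar_zero]

lemma multiDeriv_const_add_re_trigSum (m : Fin d → ℕ) (C : ℝ) (θ : Fin d → ℝ) :
    multiDeriv m (fun θ => C + (trigSum L c θ).re) θ =
      ((∏ i, (0 : ℂ) ^ m i) * (C : ℂ)).re +
        (trigSum L (fun k => (∏ i, (Complex.I * L k i) ^ m i) * c k) θ).re := by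
  rw [const_add_re_trigSum, multiDeriv_re_trigSum]
  simp [trigSum, Fintype.sum_option, expChar_zero]

lemma continuous_multiDeriv_const_add_re_trigSum (m : Fin d → ℕ) (C : ℝ) :
    Continuous (multiDeriv m (fun θ => C + (trigSum L c θ).re)) := by
  rw [funext (multiDeriv_const_add_re_trigSum L c m C)]
  exact continuous_const.add (Complex.continuous_re.comp (continuous_trigSum _ _))

end Deriv

/-! ### Wave packets -/

/-- The frequencies of the block `[R, 2R)^d`. -/
def blockFreq (R : ℕ) (a : Fin d → Fin R) : Fin d → ℤ := fun i => (R : ℤ) + (a i : ℕ)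

/-- The Dirichlet kernel of the block `[R, 2R)^d`. -/
def blockSum (R : ℕ) (θ : Fin d → ℝ) : ℂ :=
  trigSum (blockFreq R) (fun _ => 1) θ

/-- The points of the regular grid with `R ^ d` points. -/
def gridPoint (R : ℕ) (τ : Fin d → Fin R) : Fin d → ℝ :=
  fun i => 2 * Real.pi * (τ i : ℝ) / R

/-- The frequencies of the square of the Dirichlet kernel of a block, with repetitions. -/
def pairFreq (R : ℕ) (ab : (Fin d → Fin R) × (Fin d → Fin R)) : Fin d → ℤ :=
  blockFreq R ab.1 + blockFreq R ab.2

/-- The Fourier coefficients of the superposition, with weights `ε`, of squared block kernels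
centred at the grid points. The phase `(-i)^M` turns a derivative of order `M` at the centre of a
packet into a sum of positive terms. -/
def packetCoeff (R M : ℕ) (γ : ℝ) (ε : (Fin d → Fin R) → ℝ)
    (ab : (Fin d → Fin R) × (Fin d → Fin R)) : ℂ :=
  γ * (-Complex.I) ^ M * ∑ τ, (ε τ : ℂ) * expChar (-pairFreq R ab) (gridPoint R τ)

variable {R : ℕ}

lemma blockFreq_injective : Function.Injective (blockFreq (d := d) R) := by
  intro a b h
  funext i
  have := congrFun h i
  simp only [blockFreq, add_right_inj, Nat.cast_inj] at this
  exact Fin.ext this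

lemma blockSum_sq (θ : Fin d → ℝ) :
    blockSum R θ ^ 2 = ∑ ab : (Fin d → Fin R) × (Fin d → Fin R), expChar (pairFreq R ab) θ := by
  simp only [blockSum, trigSum, one_mul, sq, Finset.sum_mul_sum, pairFreq, expChar_add_left,
    Fintype.sum_prod_type]

lemma trigSum_packetCoeff (M : ℕ) (γ : ℝ) (ε : (Fin d → Fin R) → ℝ) (θ : Fin d → ℝ) :
    trigSum (pairFreq R) (packetCoeff R M γ ε) θ =
      γ * (-Complex.I) ^ M * ∑ τ, (ε τ : ℂ) * blockSum R (θ - gridPoint R τ) ^ 2 := by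
  simp only [trigSum, packetCoeff, blockSum_sq, sub_eq_add_neg, expChar_add_right,
    expChar_neg_right, Finset.mul_sum, Finset.sum_mul]
  rw [Finset.sum_comm]
  exact Finset.sum_congr rfl fun _ _ => Finset.sum_congr rfl fun _ _ => by ring

lemma blockSum_add (x u : Fin d → ℝ) :
    blockSum R (x + u) = trigSum (blockFreq R) (fun a => expChar (blockFreq R a) u) x := by
  simp [blockSum, trigSum_add]

lemma sum_sq_norm_expChar_block (u : Fin d → ℝ) :
    ∑ a : Fin d → Fin R, ‖expChar (blockFreq R a) u‖ ^ 2 = (R : ℝ) ^ d := by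
  simp [norm_expChar]

/-- The squared moduli of the grid translates of a block kernel add up to a constant. -/
lemma sum_sq_norm_blockSum_grid (θ : Fin d → ℝ) :
    ∑ τ : Fin d → Fin R, ‖blockSum R (θ - gridPoint R τ)‖ ^ 2 = (R : ℝ) ^ (2 * d) := by
  have h := sum_sq_norm_trigSum (L := blockFreq (d := d) R)
    (fun a => expChar (blockFreq R a) θ) (fun _ : Fin d → Fin R => (1 : ℝ))
    (fun τ => -gridPoint R τ) ((R : ℝ) ^ d) (by
      intro a b
      simp only [expChar_mul_conj, expChar_neg_right, neg_sub_neg, Complex.ofReal_one, one_mul]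
      have hlt : ∀ i, |(blockFreq R b - blockFreq R a) i| < R := by
        intro i
        have h1 := (a i).isLt
        have h2 := (b i).isLt
        simp only [blockFreq, Pi.sub_apply, abs_lt]
        omega
      refine (sum_expChar_grid hlt).trans ?_
      simp only [sub_eq_zero, blockFreq_injective.eq_iff, eq_comm (a := b)]
      push_cast
      rfl)
  rw [sum_sq_norm_expChar_block] at h
  simp only [one_mul, ← blockSum_add, neg_add_eq_sub] at h
  rw [h, two_mul, pow_add]

lemma integral_sq_norm_blockSum (u : Fin d → ℝ) :
    ∫ θ, ‖blockSum R (θ + u)‖ ^ 2 ∂(rho d) = (2 * Real.pi) ^ d * (R : ℝ) ^ d := by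
  simp only [blockSum_add]
  rw [integral_sq_norm_trigSum _ blockFreq_injective, sum_sq_norm_expChar_block]

lemma continuous_blockSum : Continuous (blockSum (d := d) R) := continuous_trigSum _ _

lemma norm_phase (M : ℕ) : ‖(-Complex.I) ^ M‖ = 1 := by simp

lemma norm_trigSum_packetCoeff_le_sum (M : ℕ) {γ : ℝ} (hγ : 0 ≤ γ) (ε : (Fin d → Fin R) → ℝ)
    (θ : Fin d → ℝ) :
    ‖trigSum (pairFreq R) (packetCoeff R M γ ε) θ‖ ≤
      γ * ∑ τ, |ε τ| * ‖blockSum R (θ - gridPoint R τ)‖ ^ 2 := by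
  rw [trigSum_packetCoeff, norm_mul, norm_mul, norm_phase, mul_one, Complex.norm_real,
    Real.norm_of_nonneg hγ]
  refine mul_le_mul_of_nonneg_left ((norm_sum_le _ _).trans (le_of_eq ?_)) hγ
  exact Finset.sum_congr rfl fun τ _ => by simp

lemma norm_trigSum_packetCoeff_le (M : ℕ) {γ : ℝ} (hγ : 0 ≤ γ) {ε : (Fin d → Fin R) → ℝ}
    (hε : ∀ τ, |ε τ| ≤ 1) (θ : Fin d → ℝ) :
    ‖trigSum (pairFreq R) (packetCoeff R M γ ε) θ‖ ≤ γ * (R : ℝ) ^ (2 * d) := by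
  refine (norm_trigSum_packetCoeff_le_sum M hγ ε θ).trans
    (mul_le_mul_of_nonneg_left ?_ hγ)
  rw [← sum_sq_norm_blockSum_grid θ]
  exact Finset.sum_le_sum fun τ _ => mul_le_of_le_one_left (sq_nonneg _) (hε τ)

/-! ### Frequencies and derivatives of wave packets -/

lemma le_pairFreq (ab : (Fin d → Fin R) × (Fin d → Fin R)) (i : Fin d) :
    2 * (R : ℝ) ≤ pairFreq R ab i := by
  have : 2 * (R : ℤ) ≤ pairFreq R ab i := by
    simp only [pairFreq, blockFreq, Pi.add_apply]
    omega
  exact_mod_cast this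

lemma pairFreq_le (ab : (Fin d → Fin R) × (Fin d → Fin R)) (i : Fin d) :
    (pairFreq R ab i : ℝ) ≤ 4 * (R : ℝ) := by
  have : pairFreq R ab i ≤ 4 * (R : ℤ) := by
    have h1 := (ab.1 i).isLt
    have h2 := (ab.2 i).isLt
    simp only [pairFreq, blockFreq, Pi.add_apply]
    omega
  exact_mod_cast this

lemma freqNorm_blockFreq_le (a : Fin d → Fin R) (ab : (Fin d → Fin R) × (Fin d → Fin R)) :
    freqNorm (blockFreq R a) ≤ freqNorm (pairFreq R ab) := by
  refine Real.sqrt_le_sqrt (Finset.sum_le_sum fun i _ => ?_)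
  have h0 : (0 : ℤ) ≤ blockFreq R a i := by simp only [blockFreq]; omega
  have h1 : blockFreq R a i ≤ pairFreq R ab i := by
    have := (a i).isLt
    simp only [pairFreq, blockFreq, Pi.add_apply]
    omega
  exact pow_le_pow_left₀ (by exact_mod_cast h0) (by exact_mod_cast h1) 2

lemma two_mul_le_freqNorm_pairFreq (hd : 0 < d) (ab : (Fin d → Fin R) × (Fin d → Fin R)) :
    2 * (R : ℝ) ≤ freqNorm (pairFreq R ab) := by
  refine Real.le_sqrt_of_sq_le ?_
  calc (2 * (R : ℝ)) ^ 2 ≤ (pairFreq R ab ⟨0, hd⟩ : ℝ) ^ 2 :=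
        pow_le_pow_left₀ (by positivity) (le_pairFreq ab _) 2
    _ ≤ _ := Finset.single_le_sum (f := fun i => (pairFreq R ab i : ℝ) ^ 2)
        (fun i _ => sq_nonneg _) (Finset.mem_univ _)

lemma freqNorm_pairFreq_le (hd : 0 < d) (ab : (Fin d → Fin R) × (Fin d → Fin R)) :
    freqNorm (pairFreq R ab) ≤ 4 * d * R := by
  refine Real.sqrt_le_iff.mpr ⟨by positivity, ?_⟩
  calc ∑ i, (pairFreq R ab i : ℝ) ^ 2 ≤ ∑ _i : Fin d, (4 * (R : ℝ)) ^ 2 := by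
        refine Finset.sum_le_sum fun i _ => pow_le_pow_left₀ ?_ (pairFreq_le ab i) 2
        exact le_trans (by positivity) (le_pairFreq ab i)
    _ = d * (4 * (R : ℝ)) ^ 2 := by simp
    _ ≤ (d : ℝ) ^ 2 * (4 * (R : ℝ)) ^ 2 := by
        have : (1 : ℝ) ≤ d := by exact_mod_cast hd
        gcongr
        nlinarith
    _ = _ := by ring

/-- The cell attached to a grid point, on which the derivatives of the packet centred there are
large. -/
def cell (d R : ℕ) (τ : Fin d → Fin R) : Set (Fin d → ℝ) :=
  Set.univ.pi fun i => Set.Ico (gridPoint R τ i) (gridPoint R τ i + 1 / (4 * d * R))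

lemma measurableSet_cell (τ : Fin d → Fin R) : MeasurableSet (cell d R τ) :=
  MeasurableSet.univ_pi fun _ => measurableSet_Ico

lemma cell_width_le (hd : 0 < d) (hR : 0 < R) : 1 / (4 * d * R : ℝ) ≤ 2 * Real.pi / R := by
  have hd' : (1 : ℝ) ≤ d := by exact_mod_cast hd
  have hR' : (0 : ℝ) < R := by exact_mod_cast hR
  rw [div_le_div_iff₀ (by positivity) hR']
  have : 1 ≤ 2 * Real.pi * (4 * d) := by nlinarith [Real.pi_gt_three]
  nlinarith

lemma gridPoint_add_width_le {τ τ' : Fin d → Fin R} {i : Fin d} (hd : 0 < d) (hR : 0 < R)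
    (h : τ i < τ' i) : gridPoint R τ i + 1 / (4 * d * R) ≤ gridPoint R τ' i := by
  have hR' : (0 : ℝ) < R := by exact_mod_cast hR
  have h1 : ((τ i : ℕ) : ℝ) + 1 ≤ (τ' i : ℕ) := by exact_mod_cast h
  calc gridPoint R τ i + 1 / (4 * d * R) ≤ gridPoint R τ i + 2 * Real.pi / R :=
        add_le_add_right (cell_width_le hd hR) _
    _ = 2 * Real.pi * ((τ i : ℝ) + 1) / R := by rw [gridPoint]; ring
    _ ≤ _ := by
        rw [gridPoint]
        have := Real.pi_pos
        gcongr

lemma disjoint_cell (hd : 0 < d) (hR : 0 < R) {τ τ' : Fin d → Fin R} (h : τ ≠ τ') :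
    Disjoint (cell d R τ) (cell d R τ') := by
  obtain ⟨i, hi⟩ := Function.ne_iff.mp h
  rw [Set.disjoint_left]
  intro x hx hx'
  have h1 := hx i (Set.mem_univ i)
  have h2 := hx' i (Set.mem_univ i)
  rcases lt_or_gt_of_ne hi with hlt | hlt
  · linarith [gridPoint_add_width_le hd hR hlt, h1.2, h2.1]
  · linarith [gridPoint_add_width_le hd hR hlt, h2.2, h1.1]

lemma cell_subset_cube (hd : 0 < d) (hR : 0 < R) (τ : Fin d → Fin R) :
    cell d R τ ⊆ cube d := by
  intro x hx i _
  have h := hx i (Set.mem_univ i)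
  have hR' : (0 : ℝ) < R := by exact_mod_cast hR
  have hpi := Real.pi_pos
  refine ⟨le_trans (by rw [gridPoint]; positivity) h.1, h.2.trans_le ?_⟩
  have h1 : ((τ i : ℕ) : ℝ) + 1 ≤ R := by exact_mod_cast (τ i).isLt
  calc gridPoint R τ i + 1 / (4 * d * R) ≤ gridPoint R τ i + 2 * Real.pi / R :=
        add_le_add_right (cell_width_le hd hR) _
    _ = 2 * Real.pi * (((τ i : ℝ) + 1) / R) := by rw [gridPoint]; ring
    _ ≤ 2 * Real.pi * 1 := by
        gcongr
        rwa [div_le_one hR']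
    _ = _ := mul_one _

lemma rho_cell (hd : 0 < d) (hR : 0 < R) (τ : Fin d → Fin R) :
    rho d (cell d R τ) = ENNReal.ofReal ((1 / (4 * d * R)) ^ d) := by
  rw [rho, Measure.restrict_apply (measurableSet_cell τ),
    Set.inter_eq_left.mpr (cell_subset_cube hd hR τ), cell, volume_pi_pi]
  simp only [Real.volume_Ico, add_sub_cancel_left, Finset.prod_const, Finset.card_univ,
    Fintype.card_fin]
  rw [ENNReal.ofReal_pow (by positivity)]

lemma prod_I_mul_pow (l : Fin d → ℤ) (m : Fin d → ℕ) :
    ∏ i, (Complex.I * l i) ^ m i = Complex.I ^ order m * ((∏ i, (l i : ℝ) ^ m i : ℝ) : ℂ) := by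
  simp only [mul_pow, Finset.prod_mul_distrib, Finset.prod_pow_eq_pow_sum, order]
  push_cast
  rfl

/-- If two weight vectors differ by `2` at a single grid point, the derivatives of the two
superpositions of packets differ by at least `γ R^{2d} R^{|m|}` on the cell of this point. -/
lemma le_multiDeriv_sub_multiDeriv (m : Fin d → ℕ) (C : ℝ) {γ : ℝ} (hγ : 0 ≤ γ) (hR : 0 < R)
    (hd : 0 < d) {ε ε' : (Fin d → Fin R) → ℝ} {τ : Fin d → Fin R} (hτ : ε τ - ε' τ = 2)
    (hne : ∀ σ, σ ≠ τ → ε σ = ε' σ) {θ : Fin d → ℝ} (hθ : θ ∈ cell d R τ) :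
    γ * (R : ℝ) ^ (2 * d) * (R : ℝ) ^ order m ≤
      multiDeriv m (fun θ => C + (trigSum (pairFreq R) (packetCoeff R (order m) γ ε) θ).re) θ -
      multiDeriv m (fun θ => C + (trigSum (pairFreq R) (packetCoeff R (order m) γ ε') θ).re) θ := by
  have hdiff : ∀ ab, packetCoeff R (order m) γ ε ab - packetCoeff R (order m) γ ε' ab =
      γ * (-Complex.I) ^ order m * (2 * expChar (-pairFreq R ab) (gridPoint R τ)) := by
    intro ab
    rw [packetCoeff, packetCoeff, ← mul_sub, ← Finset.sum_sub_distrib]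
    congr 1
    rw [Finset.sum_eq_single τ]
    · rw [← sub_mul]
      congr 1
      exact_mod_cast hτ
    · intro σ _ hσ
      rw [hne σ hσ, sub_self]
    · simp
  have hphase : Complex.I ^ order m * (-Complex.I) ^ order m = 1 := by
    rw [← mul_pow]
    simp
  have hmain : multiDeriv m
        (fun θ => C + (trigSum (pairFreq R) (packetCoeff R (order m) γ ε) θ).re) θ -
      multiDeriv m
        (fun θ => C + (trigSum (pairFreq R) (packetCoeff R (order m) γ ε') θ).re) θ =
      ∑ ab : (Fin d → Fin R) × (Fin d → Fin R), 2 * γ * ((∏ i, (pairFreq R ab i : ℝ) ^ m i) *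
        Real.cos (∑ i, (pairFreq R ab i : ℝ) * (θ - gridPoint R τ) i)) := by
    rw [multiDeriv_const_add_re_trigSum, multiDeriv_const_add_re_trigSum, add_sub_add_left_eq_sub,
      ← Complex.sub_re, trigSum, trigSum, ← Finset.sum_sub_distrib, Complex.re_sum]
    refine Finset.sum_congr rfl fun ab _ => ?_
    rw [← sub_mul, ← mul_sub, hdiff, prod_I_mul_pow, ← expChar_re, sub_eq_add_neg,
      expChar_add_right, expChar_neg_right]
    set x := expChar (-pairFreq R ab) (gridPoint R τ)
    set y := expChar (pairFreq R ab) θ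
    set Q := ∏ i, (pairFreq R ab i : ℝ) ^ m i
    calc _ = ((Complex.I ^ order m * (-Complex.I) ^ order m) *
          (((2 * γ * Q : ℝ) : ℂ) * (y * x))).re := by
            congr 1
            push_cast
            ring
      _ = _ := by
            rw [hphase, one_mul, Complex.re_ofReal_mul]
            ring
  rw [hmain]
  have hterm : ∀ ab : (Fin d → Fin R) × (Fin d → Fin R), γ * (R : ℝ) ^ order m ≤
      2 * γ * ((∏ i, (pairFreq R ab i : ℝ) ^ m i) *
        Real.cos (∑ i, (pairFreq R ab i : ℝ) * (θ - gridPoint R τ) i)) := by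
    intro ab
    have hR' : (0 : ℝ) < R := by exact_mod_cast hR
    have hd' : (0 : ℝ) < d := by exact_mod_cast hd
    have hL : ∀ i, (0 : ℝ) ≤ pairFreq R ab i := fun i =>
      le_trans (by positivity) (le_pairFreq ab i)
    have hu : ∀ i, 0 ≤ (θ - gridPoint R τ) i ∧ (θ - gridPoint R τ) i ≤ 1 / (4 * d * R) :=
      fun i => ⟨sub_nonneg.mpr (hθ i (Set.mem_univ i)).1,
        by rw [Pi.sub_apply]; linarith [(hθ i (Set.mem_univ i)).2]⟩
    have h0 : 0 ≤ ∑ i, (pairFreq R ab i : ℝ) * (θ - gridPoint R τ) i :=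
      Finset.sum_nonneg fun i _ => mul_nonneg (hL i) (hu i).1
    have h1 : ∑ i, (pairFreq R ab i : ℝ) * (θ - gridPoint R τ) i ≤ 1 := by
      calc _ ≤ ∑ _i : Fin d, 4 * (R : ℝ) * (1 / (4 * d * R)) :=
            Finset.sum_le_sum fun i _ =>
              mul_le_mul (pairFreq_le ab i) (hu i).2 (hu i).1 (by positivity)
        _ = 1 := by
            simp only [Finset.sum_const, Finset.card_univ, Fintype.card_fin, nsmul_eq_mul]
            field_simp
    have hcos : 1 / 2 ≤ Real.cos (∑ i, (pairFreq R ab i : ℝ) * (θ - gridPoint R τ) i) := by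
      refine le_trans ?_ Real.one_sub_sq_div_two_le_cos
      nlinarith
    have hprod : (R : ℝ) ^ order m ≤ ∏ i, (pairFreq R ab i : ℝ) ^ m i := by
      rw [order, ← Finset.prod_pow_eq_pow_sum]
      refine Finset.prod_le_prod (fun i _ => by positivity) fun i _ => ?_
      exact pow_le_pow_left₀ hR'.le (by linarith [le_pairFreq ab i]) _
    calc γ * (R : ℝ) ^ order m = 2 * γ * ((R : ℝ) ^ order m * (1 / 2)) := by ring
      _ ≤ _ := by
        have hQ := le_trans (by positivity) hprod
        gcongr
  calc γ * (R : ℝ) ^ (2 * d) * (R : ℝ) ^ order m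
      = ∑ _ab : (Fin d → Fin R) × (Fin d → Fin R), γ * (R : ℝ) ^ order m := by
        simp [two_mul, pow_add]
        ring
    _ ≤ _ := Finset.sum_le_sum fun ab _ => hterm ab

end

section

variable {d : ℕ}

/-! ### Needlet coefficients of trigonometric polynomials -/

namespace NeedletSystem

variable (N : NeedletSystem d)

lemma B_pos : 0 < N.B := zero_lt_one.trans N.one_lt_B

lemma b_zero : N.b 0 = 0 :=
  N.b_support 0 fun h => absurd h.1 (not_le.mpr (inv_pos.mpr N.B_pos))

lemma le_of_b_ne_zero {l : Fin d → ℤ} {j : ℕ} (h : N.b (freqNorm l / N.B ^ j) ≠ 0) :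
    freqNorm l ≤ N.B ^ (j + 1) ∧ N.B ^ j ≤ N.B * freqNorm l := by
  have hmem : freqNorm l / N.B ^ j ∈ Set.Icc N.B⁻¹ N.B := by
    by_contra hc
    exact h (N.b_support _ hc)
  have hB := N.B_pos
  have hj : 0 < N.B ^ j := pow_pos hB j
  refine ⟨?_, ?_⟩
  · have := (div_le_iff₀ hj).mp hmem.2
    rwa [pow_succ, mul_comm]
  · have := (le_div_iff₀ hj).mp hmem.1
    rwa [inv_mul_le_iff₀ hB] at this

lemma finite_support_b (j : ℕ) :
    {l : Fin d → ℤ | N.b (freqNorm l / N.B ^ j) ≠ 0}.Finite := by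
  obtain ⟨n, hn⟩ := exists_nat_ge (N.B ^ (j + 1))
  refine (Set.finite_Icc (fun _ : Fin d => -(n : ℤ)) (fun _ => (n : ℤ))).subset fun l hl => ?_
  have h1 : freqNorm l ≤ n := ((N.le_of_b_ne_zero hl).1).trans hn
  have h2 : ∀ i, |l i| ≤ n := by
    intro i
    have h3 : |(l i : ℝ)| ≤ freqNorm l := by
      refine Real.abs_le_sqrt ?_
      exact Finset.single_le_sum (f := fun i => (l i : ℝ) ^ 2) (fun i _ => sq_nonneg _)
        (Finset.mem_univ i)
    exact_mod_cast h3.trans h1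
  exact ⟨fun i => (abs_le.mp (h2 i)).1, fun i => (abs_le.mp (h2 i)).2⟩

lemma sq_fourierS_const :
    ((2 * Real.pi) ^ (-(d : ℝ) / 2)) * ((2 * Real.pi) ^ (-(d : ℝ) / 2)) * (2 * Real.pi) ^ d =
      1 := by
  rw [← Real.rpow_natCast, ← Real.rpow_add Real.two_pi_pos, ← Real.rpow_add Real.two_pi_pos]
  ring_nf
  simp

lemma conj_needlet_eq_sum (j : ℕ) (k : Fin (N.K j)) (θ : Fin d → ℝ) :
    conj (N.needlet j k θ) = ∑ l ∈ (N.finite_support_b j).toFinset,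
      ((Real.sqrt (N.lam j k) * N.b (freqNorm l / N.B ^ j) *
        ((2 * Real.pi) ^ (-(d : ℝ) / 2) * (2 * Real.pi) ^ (-(d : ℝ) / 2)) : ℝ) : ℂ) *
        expChar l (N.ξ j k) * conj (expChar l θ) := by
  rw [needlet, tsum_eq_sum (s := (N.finite_support_b j).toFinset), map_mul, map_sum,
    Complex.conj_ofReal, Finset.mul_sum]
  · refine Finset.sum_congr rfl fun l _ => ?_
    simp only [fourierS_eq, map_mul, Complex.conj_ofReal, Complex.conj_conj]
    push_cast
    ring
  · intro l hl
    rw [Set.Finite.mem_toFinset, Set.mem_ofPred_eq, not_not] at hl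
    rw [hl]
    simp

lemma integrable_expChar_mul_conj (l l' : Fin d → ℤ) :
    Integrable (fun θ => expChar l θ * conj (expChar l' θ)) (rho d) := by
  simp only [expChar_mul_conj]
  exact integrable_of_continuous_bounded (continuous_expChar _) fun x => (norm_expChar _ x).le

lemma integrable_expChar_mul_conj_needlet (l : Fin d → ℤ) (j : ℕ) (k : Fin (N.K j)) :
    Integrable (fun θ => expChar l θ * conj (N.needlet j k θ)) (rho d) := by
  simp only [conj_needlet_eq_sum, Finset.mul_sum]
  refine integrable_finsetSum _ fun l' _ => ?_
  simp only [mul_left_comm (expChar l _)]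
  exact (integrable_expChar_mul_conj l l').const_mul _

lemma integral_expChar_mul_conj_needlet (l : Fin d → ℤ) (j : ℕ) (k : Fin (N.K j)) :
    ∫ θ, expChar l θ * conj (N.needlet j k θ) ∂(rho d) =
      (Real.sqrt (N.lam j k) : ℂ) *
        ((N.b (freqNorm l / N.B ^ j) : ℂ) * expChar l (N.ξ j k)) := by
  simp only [conj_needlet_eq_sum, Finset.mul_sum, mul_left_comm (expChar l _)]
  rw [integral_finsetSum _ fun l' _ => (integrable_expChar_mul_conj l l').const_mul _]
  simp only [integral_const_mul, integral_expChar_mul_conj, mul_ite, mul_zero, Finset.sum_ite_eq]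
  split_ifs with h
  · have := congrArg (fun x : ℝ => (x : ℂ)) (sq_fourierS_const (d := d))
    push_cast at this ⊢
    linear_combination (Real.sqrt (N.lam j k) : ℂ) *
        ((N.b (freqNorm l / N.B ^ j) : ℂ) * expChar l (N.ξ j k)) * this
  · rw [Set.Finite.mem_toFinset, Set.mem_ofPred_eq, not_not] at h
    simp [h]

lemma freqNorm_neg (l : Fin d → ℤ) : freqNorm (-l) = freqNorm l := by
  simp [freqNorm]

/-- The needlet coefficients are samples, at the cubature points, of the function filtered by the
Fourier multiplier `b(|·| / B^j)`. -/
lemma coeff_re_trigSum {ι : Type*} [Fintype ι] (L : ι → Fin d → ℤ) (c : ι → ℂ) (j : ℕ)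
    (k : Fin (N.K j)) :
    N.coeff (fun θ => (trigSum L c θ).re) j k = (Real.sqrt (N.lam j k) : ℂ) *
      ((trigSum L (fun i => (N.b (freqNorm (L i) / N.B ^ j) : ℂ) * c i) (N.ξ j k)).re : ℂ) := by
  have h1 : ∀ θ, (((trigSum L c θ).re : ℝ) : ℂ) * conj (N.needlet j k θ) =
      ∑ i, ((c i / 2) * (expChar (L i) θ * conj (N.needlet j k θ)) +
        (conj (c i) / 2) * (expChar (-L i) θ * conj (N.needlet j k θ))) := by
    intro θ
    rw [Complex.re_eq_add_conj, trigSum, map_sum, ← Finset.sum_add_distrib, Finset.sum_div,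
      Finset.sum_mul]
    refine Finset.sum_congr rfl fun i _ => ?_
    rw [map_mul, expChar_neg_left]
    ring
  have hint : ∀ i, Integrable (fun θ =>
      (c i / 2) * (expChar (L i) θ * conj (N.needlet j k θ)) +
        (conj (c i) / 2) * (expChar (-L i) θ * conj (N.needlet j k θ))) (rho d) := fun i =>
    ((N.integrable_expChar_mul_conj_needlet _ j k).const_mul _).add
      ((N.integrable_expChar_mul_conj_needlet _ j k).const_mul _)
  rw [coeff]
  simp only [h1]
  rw [integral_finsetSum _ fun i _ => hint i,
    Complex.re_eq_add_conj, trigSum, map_sum, ← Finset.sum_add_distrib, Finset.sum_div,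
    Finset.mul_sum]
  refine Finset.sum_congr rfl fun i _ => ?_
  rw [integral_add ((N.integrable_expChar_mul_conj_needlet _ j k).const_mul _)
      ((N.integrable_expChar_mul_conj_needlet _ j k).const_mul _),
    integral_const_mul, integral_const_mul, integral_expChar_mul_conj_needlet,
    integral_expChar_mul_conj_needlet, freqNorm_neg, expChar_neg_left]
  simp only [map_mul, Complex.conj_ofReal]
  ring

/-- Constants do not contribute to the needlet coefficients. -/
lemma norm_coeff_le {ι : Type*} [Fintype ι] (L : ι → Fin d → ℤ) (c : ι → ℂ) (C : ℝ) (j : ℕ)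
    (k : Fin (N.K j)) :
    ‖N.coeff (fun θ => C + (trigSum L c θ).re) j k‖ ≤ Real.sqrt (N.lam j k) *
      ‖trigSum L (fun i => (N.b (freqNorm (L i) / N.B ^ j) : ℂ) * c i) (N.ξ j k)‖ := by
  rw [const_add_re_trigSum, coeff_re_trigSum, norm_mul, Complex.norm_real, Complex.norm_real,
    Real.norm_of_nonneg (Real.sqrt_nonneg _)]
  refine mul_le_mul_of_nonneg_left ?_ (Real.sqrt_nonneg _)
  have h0 : freqNorm (0 : Fin d → ℤ) = 0 := by simp [freqNorm]
  simp only [trigSum, Fintype.sum_option, Option.elim_none, Option.elim_some, h0, zero_div,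
    N.b_zero, Complex.ofReal_zero, zero_mul, zero_add]
  exact Complex.abs_re_le_norm _

/-! ### The multiplier as a superposition of translations -/

lemma contDiff_radial : ContDiff ℝ ∞ fun x : EuclideanSpace ℝ (Fin d) => (N.b ‖x‖ : ℂ) := by
  refine Complex.ofRealCLM.contDiff.comp (contDiff_iff_contDiffAt.mpr fun x => ?_)
  rcases eq_or_ne x 0 with rfl | hx
  · have h : (fun x : EuclideanSpace ℝ (Fin d) => N.b ‖x‖) =ᶠ[nhds 0] fun _ => 0 := by
      filter_upwards [Metric.ball_mem_nhds (0 : EuclideanSpace ℝ (Fin d)) (inv_pos.mpr N.B_pos)]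
        with y hy
      refine N.b_support _ fun hc => ?_
      rw [mem_ball_zero_iff] at hy
      exact absurd hc.1 (not_le.mpr hy)
    exact contDiffAt_const.congr_of_eventuallyEq h
  · exact N.b_smooth.contDiffAt.comp x (contDiffAt_norm ℝ hx)

lemma hasCompactSupport_radial :
    HasCompactSupport fun x : EuclideanSpace ℝ (Fin d) => (N.b ‖x‖ : ℂ) := by
  refine HasCompactSupport.intro (isCompact_closedBall 0 N.B) fun x hx => ?_
  rw [mem_closedBall_zero_iff, not_le] at hx
  rw [N.b_support _ fun hc => absurd hc.2 (not_le.mpr hx), Complex.ofReal_zero]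

open scoped FourierTransform in
/-- By Fourier inversion the multiplier `b(|·| / B^j)` is an average of translations, against an
integrable density that does not depend on `j`. -/
lemma exists_integrable_kernel : ∃ κ : EuclideanSpace ℝ (Fin d) → ℂ, Integrable κ ∧
    ∀ (j : ℕ) (l : Fin d → ℤ), (N.b (freqNorm l / N.B ^ j) : ℂ) =
      ∫ v, κ v * expChar l (fun i => 2 * Real.pi / N.B ^ j * v i) := by
  let F : SchwartzMap (EuclideanSpace ℝ (Fin d)) ℂ :=
    N.hasCompactSupport_radial.toSchwartzMap N.contDiff_radial
  let K : SchwartzMap (EuclideanSpace ℝ (Fin d)) ℂ := 𝓕 F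
  refine ⟨K, K.integrable, fun j l => ?_⟩
  have hB : 0 < N.B ^ j := pow_pos N.B_pos j
  let x : EuclideanSpace ℝ (Fin d) := WithLp.toLp 2 fun i => (l i : ℝ) / N.B ^ j
  have hx : ‖x‖ = freqNorm l / N.B ^ j := by
    rw [EuclideanSpace.norm_eq, freqNorm]
    simp only [x, Real.norm_eq_abs, sq_abs, div_pow]
    rw [← Finset.sum_div, Real.sqrt_div (Finset.sum_nonneg fun i _ => sq_nonneg _),
      Real.sqrt_sq hB.le]
  have hinv : (𝓕⁻ K) x = F x := by rw [FourierTransform.fourierInv_fourier_eq]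
  have hF : F x = (N.b (freqNorm l / N.B ^ j) : ℂ) := by
    rw [← hx]
    rfl
  rw [← hF, ← hinv, SchwartzMap.fourierInv_coe, Real.fourierInv_eq']
  refine integral_congr_ae (.of_forall fun v => ?_)
  simp only [smul_eq_mul]
  rw [mul_comm, expChar]
  congr 2
  rw [mul_comm Complex.I]
  congr 2
  rw [PiLp.inner_apply, Finset.mul_sum]
  refine Finset.sum_congr rfl fun i _ => ?_
  simp only [x, RCLike.inner_apply, conj_trivial]
  field_simp

section Filter

variable {ι : Type*} [Fintype ι] (L : ι → Fin d → ℤ) (c : ι → ℂ)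

lemma integrable_kernel_mul_trigSum {κ : EuclideanSpace ℝ (Fin d) → ℂ} (hκ : Integrable κ)
    (a : ℝ) (x : Fin d → ℝ) :
    Integrable fun v => κ v * trigSum L c (x + fun i => a * v i) := by
  refine hκ.mul_bdd (c := ∑ i, ‖c i‖) ?_ (.of_forall fun v => norm_trigSum_le L c _)
  refine Continuous.aestronglyMeasurable ((continuous_trigSum L c).comp ?_)
  fun_prop

lemma trigSum_filter_eq_integral {κ : EuclideanSpace ℝ (Fin d) → ℂ} (hκ : Integrable κ) {j : ℕ}
    (h : ∀ l : Fin d → ℤ, (N.b (freqNorm l / N.B ^ j) : ℂ) =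
      ∫ v, κ v * expChar l (fun i => 2 * Real.pi / N.B ^ j * v i)) (x : Fin d → ℝ) :
    trigSum L (fun i => (N.b (freqNorm (L i) / N.B ^ j) : ℂ) * c i) x =
      ∫ v, κ v * trigSum L c (x + fun i => 2 * Real.pi / N.B ^ j * v i) := by
  have hint : ∀ i, Integrable fun v : EuclideanSpace ℝ (Fin d) =>
      c i * expChar (L i) x *
        (κ v * expChar (L i) (fun n => 2 * Real.pi / N.B ^ j * v n)) := by
    intro i
    refine Integrable.const_mul (hκ.mul_bdd (c := 1) ?_ (.of_forall fun v =>
      (norm_expChar _ _).le)) _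
    refine Continuous.aestronglyMeasurable ((continuous_expChar _).comp ?_)
    fun_prop
  have h1 : ∀ v : EuclideanSpace ℝ (Fin d),
      κ v * trigSum L c (x + fun i => 2 * Real.pi / N.B ^ j * v i) =
        ∑ i, c i * expChar (L i) x *
          (κ v * expChar (L i) (fun n => 2 * Real.pi / N.B ^ j * v n)) := by
    intro v
    rw [trigSum, Finset.mul_sum]
    refine Finset.sum_congr rfl fun i _ => ?_
    rw [expChar_add_right]
    ring
  simp only [h1]
  rw [integral_finsetSum _ fun i _ => hint i, trigSum]
  refine Finset.sum_congr rfl fun i _ => ?_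
  rw [integral_const_mul, ← h]
  ring

end Filter

/-! ### Sequence norms -/

/-- Interpolation between `ℓ¹` and `ℓ^∞` for a finite sequence. -/
lemma eLpNorm_count_le_of_sum_le {n : ℕ} (u : Fin n → ℂ) {U V : ℝ} (hU : 0 ≤ U) (hV : 0 ≤ V)
    (hu : ∀ k, ‖u k‖ ≤ U) (hs : ∑ k, ‖u k‖ ≤ V) {r : ℝ≥0∞} (hr : 1 ≤ r) :
    eLpNorm u r Measure.count ≤
      ENNReal.ofReal (U ^ (1 - (r⁻¹).toReal) * V ^ (r⁻¹).toReal) := by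
  rcases eq_or_ne r ⊤ with rfl | hr'
  · simp only [ENNReal.inv_top, ENNReal.toReal_zero, sub_zero, Real.rpow_one, Real.rpow_zero,
      mul_one]
    rw [eLpNorm_exponent_top]
    refine eLpNormEssSup_le_of_ae_bound (.of_forall hu)
  · have hr0 : r ≠ 0 := (zero_lt_one.trans_le hr).ne'
    have hr1 : 1 ≤ r.toReal := by
      rw [← ENNReal.toReal_one]
      exact ENNReal.toReal_mono hr' hr
    have hrp : 0 < r.toReal := by linarith
    rw [eLpNorm_eq_lintegral_rpow_enorm_toReal hr0 hr', lintegral_count, tsum_fintype,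
      ENNReal.toReal_inv]
    have h1 : ∑ k, ‖u k‖ₑ ^ r.toReal ≤ ENNReal.ofReal (U ^ (r.toReal - 1) * V) := by
      calc ∑ k, ‖u k‖ₑ ^ r.toReal ≤ ∑ k, ENNReal.ofReal (U ^ (r.toReal - 1) * ‖u k‖) := by
            refine Finset.sum_le_sum fun k _ => ?_
            rw [← ofReal_norm, ENNReal.ofReal_rpow_of_nonneg (norm_nonneg _) hrp.le]
            refine ENNReal.ofReal_le_ofReal ?_
            rcases (norm_nonneg (u k)).eq_or_lt with h0 | h0
            · rw [← h0, Real.zero_rpow hrp.ne', mul_zero]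
            calc ‖u k‖ ^ r.toReal = ‖u k‖ ^ (r.toReal - 1) * ‖u k‖ := by
                  rw [← Real.rpow_add_one h0.ne', sub_add_cancel]
              _ ≤ _ := by
                  refine mul_le_mul_of_nonneg_right ?_ h0.le
                  exact Real.rpow_le_rpow h0.le (hu k) (by linarith)
        _ = ENNReal.ofReal (U ^ (r.toReal - 1) * ∑ k, ‖u k‖) := by
            rw [Finset.mul_sum, ENNReal.ofReal_sum_of_nonneg]
            exact fun k _ => mul_nonneg (Real.rpow_nonneg hU _) (norm_nonneg _)
        _ ≤ _ := ENNReal.ofReal_le_ofReal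
            (mul_le_mul_of_nonneg_left hs (Real.rpow_nonneg hU _))
    refine (ENNReal.rpow_le_rpow h1 (by positivity)).trans (le_of_eq ?_)
    rw [ENNReal.ofReal_rpow_of_nonneg (mul_nonneg (Real.rpow_nonneg hU _) hV) (by positivity),
      Real.mul_rpow (Real.rpow_nonneg hU _) hV, ← Real.rpow_mul hU]
    congr 3
    · field_simp
    · rw [one_div]

lemma eLpNorm_count_le_of_finset (u : ℕ → ℝ≥0∞) (J : Finset ℕ) {X : ℝ≥0∞}
    (hu : ∀ j, u j ≤ X) (h0 : ∀ j, j ∉ J → u j = 0) (q : ℝ≥0∞) :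
    eLpNorm u q Measure.count ≤ X * (J.card : ℝ≥0∞) ^ q.toReal⁻¹ := by
  have h1 : u = (J : Set ℕ).indicator u := by
    funext j
    by_cases hj : j ∈ J
    · rw [Set.indicator_of_mem (by exact_mod_cast hj)]
    · rw [Set.indicator_of_notMem (by exact_mod_cast hj), h0 j hj]
  rw [h1, eLpNorm_indicator_eq_eLpNorm_restrict J.measurableSet]
  have h2 := eLpNorm_le_of_ae_enorm_bound (p := q) (f := u) (C := X)
    (μ := Measure.count.restrict (J : Set ℕ)) (.of_forall fun j => by simpa using hu j)
  rwa [Measure.restrict_apply_univ, Measure.count_apply_finset, smul_eq_mul] at h2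

/-- Only boundedly many levels of resolution see the frequencies of size `R`. -/
lemma exists_levels : ∃ n₀ : ℕ, ∀ R : ℝ, 0 < R → ∃ J : Finset ℕ, J.card ≤ n₀ ∧
    ∀ j : ℕ, 2 * R ≤ N.B ^ (j + 1) → N.B ^ j ≤ N.B * (4 * d * R) → j ∈ J := by
  classical
  obtain ⟨n₀, hn₀⟩ := pow_unbounded_of_one_lt (2 * d * N.B ^ 2) N.one_lt_B
  have hB := N.B_pos
  refine ⟨n₀, fun R hR => ?_⟩
  by_cases hex : ∃ j : ℕ, 2 * R ≤ N.B ^ (j + 1)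
  · refine ⟨Finset.Ico (Nat.find hex) (Nat.find hex + n₀), by simp, fun j h1 h2 => ?_⟩
    have hle : Nat.find hex ≤ j := Nat.find_min' hex h1
    refine Finset.mem_Ico.mpr ⟨hle, ?_⟩
    obtain ⟨i, rfl⟩ := Nat.exists_eq_add_of_le hle
    have h3 := Nat.find_spec hex
    rw [add_lt_add_iff_left, ← pow_lt_pow_iff_right₀ N.one_lt_B]
    refine lt_of_le_of_lt ?_ hn₀
    have h4 : 2 * R * N.B ^ i ≤ 2 * R * (2 * d * N.B ^ 2) := by
      calc 2 * R * N.B ^ i ≤ N.B ^ (Nat.find hex + 1) * N.B ^ i := by gcongr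
        _ = N.B * N.B ^ (Nat.find hex + i) := by ring
        _ ≤ N.B * (N.B * (4 * d * R)) := by gcongr
        _ = _ := by ring
    exact le_of_mul_le_mul_left h4 (by positivity)
  · exact ⟨∅, by simp, fun j h1 _ => absurd ⟨j, h1⟩ hex⟩

lemma exists_sqrt_lam_le : ∃ D : ℝ, 0 < D ∧ ∀ (j : ℕ) (k : Fin (N.K j)),
    Real.sqrt (N.lam j k) ≤ D * (N.B ^ ((j : ℝ) * d / 2))⁻¹ ∧
    Real.sqrt (N.lam j k) ≤ D * N.B ^ ((j : ℝ) * d / 2) * N.lam j k := by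
  obtain ⟨c, C, hc, h⟩ := N.lam_size
  have hB := N.B_pos
  refine ⟨max (Real.sqrt C) (Real.sqrt c)⁻¹, lt_max_of_lt_right (by positivity), fun j k => ?_⟩
  set y := N.B ^ ((j : ℝ) * d / 2) with hy
  have hy0 : 0 < y := Real.rpow_pos_of_pos hB _
  have hy2 : N.B ^ (-((j : ℝ) * d)) = (y⁻¹) ^ 2 := by
    rw [hy, ← Real.rpow_neg hB.le, ← Real.rpow_natCast, ← Real.rpow_mul hB.le]
    congr 1
    push_cast
    ring
  have hsq : Real.sqrt (N.B ^ (-((j : ℝ) * d))) = y⁻¹ := by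
    rw [hy2, Real.sqrt_sq (by positivity)]
  obtain ⟨h1, h2⟩ := h j k
  have hl := N.lam_pos j k
  refine ⟨?_, ?_⟩
  · calc Real.sqrt (N.lam j k) ≤ Real.sqrt (C * N.B ^ (-((j : ℝ) * d))) := Real.sqrt_le_sqrt h2
      _ = Real.sqrt C * y⁻¹ := by rw [Real.sqrt_mul' _ (by positivity), hsq]
      _ ≤ _ := by gcongr; exact le_max_left _ _
  · have h3 : Real.sqrt c * y⁻¹ ≤ Real.sqrt (N.lam j k) := by
      rw [← hsq, ← Real.sqrt_mul' _ (by positivity)]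
      exact Real.sqrt_le_sqrt h1
    have hsc : 0 < Real.sqrt c := Real.sqrt_pos.mpr hc
    calc Real.sqrt (N.lam j k)
        = (Real.sqrt c)⁻¹ * y * (Real.sqrt c * y⁻¹) * Real.sqrt (N.lam j k) := by field_simp
      _ ≤ (Real.sqrt c)⁻¹ * y * Real.sqrt (N.lam j k) * Real.sqrt (N.lam j k) := by gcongr
      _ = (Real.sqrt c)⁻¹ * y * N.lam j k := by
          rw [mul_assoc, Real.mul_self_sqrt hl.le]
      _ ≤ _ := by gcongr; exact le_max_right _ _

/-! ### The Besov norm of band-limited functions -/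

/-- The Besov norm of a trigonometric polynomial with frequencies of size `R`, in terms of a bound
`A` for its supremum and a bound `A W` for the `ℓ¹` norms of its samples. -/
lemma exists_besovNorm_le (hd : 0 < d) {t : ℝ} (ht : 0 ≤ t) {r : ℝ≥0∞} (hr : 1 ≤ r)
    (q : ℝ≥0∞) : ∃ C : ℝ, 0 < C ∧ ∀ (R : ℝ), 0 < R → ∀ (ι : Type) [Fintype ι]
      (L : ι → Fin d → ℤ) (c : ι → ℂ) (C₀ A W : ℝ), 0 ≤ A → 0 ≤ W →
      (∀ i, 2 * R ≤ freqNorm (L i)) → (∀ i, freqNorm (L i) ≤ 4 * d * R) →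
      (∀ θ, ‖trigSum L c θ‖ ≤ A) →
      (∀ j i, freqNorm (L i) ≤ N.B ^ (j + 1) →
        ∀ u, ∑ k, N.lam j k * ‖trigSum L c (N.ξ j k + u)‖ ≤ A * W) →
      N.besovNorm t r q (fun θ => C₀ + (trigSum L c θ).re) ≤
        ENNReal.ofReal (C * (R ^ t * A * W ^ (r⁻¹).toReal)) := by
  obtain ⟨κ, hκ, hmult⟩ := N.exists_integrable_kernel
  obtain ⟨D, hD, hlam⟩ := N.exists_sqrt_lam_le
  obtain ⟨n₀, hn₀⟩ := N.exists_levels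
  have hB := N.B_pos
  have hd' : (0 : ℝ) < d := by exact_mod_cast hd
  set ϱ := (r⁻¹).toReal with hϱ
  have hϱ0 : 0 ≤ ϱ := ENNReal.toReal_nonneg
  set E := ∫ v, ‖κ v‖ with hE
  have hE0 : 0 ≤ E := integral_nonneg fun v => norm_nonneg _
  refine ⟨D * (E + 1) * (N.B * (4 * d)) ^ t * ((n₀ : ℝ) + 1) ^ q.toReal⁻¹, by positivity, ?_⟩
  intro R hR ι _ L c C₀ A W hA hW hlow hhigh hsup hsamp
  -- the bound for one level
  have hlevel : ∀ j : ℕ, (∃ i, N.b (freqNorm (L i) / N.B ^ j) ≠ 0) →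
      ENNReal.ofReal (N.B ^ ((j : ℝ) * (t + d * (1 / 2 - ϱ)))) *
        eLpNorm (fun k : Fin (N.K j) => N.coeff (fun θ => C₀ + (trigSum L c θ).re) j k) r
          Measure.count ≤
      ENNReal.ofReal (D * (E + 1) * (N.B * (4 * d)) ^ t * (R ^ t * A * W ^ ϱ)) := by
    rintro j ⟨i₀, hi₀⟩
    obtain ⟨hj1, hj2⟩ := N.le_of_b_ne_zero hi₀
    set y := N.B ^ ((j : ℝ) * d / 2) with hy
    have hy0 : 0 < y := Real.rpow_pos_of_pos hB _
    have hfil := N.trigSum_filter_eq_integral L c hκ (hmult j)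
    have hfil1 : ∀ x, ‖trigSum L (fun i => (N.b (freqNorm (L i) / N.B ^ j) : ℂ) * c i) x‖ ≤
        ∫ v, ‖κ v‖ * ‖trigSum L c (x + fun i => 2 * Real.pi / N.B ^ j * v i)‖ := by
      intro x
      rw [hfil]
      refine (norm_integral_le_integral_norm _).trans (le_of_eq ?_)
      simp only [norm_mul]
    have hint : ∀ x, Integrable fun v : EuclideanSpace ℝ (Fin d) =>
        ‖κ v‖ * ‖trigSum L c (x + fun i => 2 * Real.pi / N.B ^ j * v i)‖ := by
      intro x
      have := (integrable_kernel_mul_trigSum L c hκ (2 * Real.pi / N.B ^ j) x).norm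
      simpa only [norm_mul] using this
    have hsup' : ∀ x, ‖trigSum L (fun i => (N.b (freqNorm (L i) / N.B ^ j) : ℂ) * c i) x‖ ≤
        E * A := by
      intro x
      refine (hfil1 x).trans ?_
      rw [hE, ← integral_mul_const]
      refine integral_mono (hint x) (hκ.norm.mul_const _) fun v => ?_
      exact mul_le_mul_of_nonneg_left (hsup _) (norm_nonneg _)
    have hsum' : ∑ k, N.lam j k *
        ‖trigSum L (fun i => (N.b (freqNorm (L i) / N.B ^ j) : ℂ) * c i) (N.ξ j k)‖ ≤
        E * (A * W) := by
      calc _ ≤ ∑ k, N.lam j k * ∫ v, ‖κ v‖ *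
              ‖trigSum L c (N.ξ j k + fun i => 2 * Real.pi / N.B ^ j * v i)‖ :=
            Finset.sum_le_sum fun k _ => mul_le_mul_of_nonneg_left (hfil1 _) (N.lam_pos j k).le
        _ = ∫ v, ∑ k, N.lam j k * (‖κ v‖ *
              ‖trigSum L c (N.ξ j k + fun i => 2 * Real.pi / N.B ^ j * v i)‖) := by
            rw [integral_finsetSum _ fun k _ => (hint _).const_mul _]
            simp only [integral_const_mul]
        _ ≤ ∫ v, ‖κ v‖ * (A * W) := by
            refine integral_mono (integrable_finsetSum _ fun k _ => (hint _).const_mul _)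
              (hκ.norm.mul_const _) fun v => ?_
            simp only [mul_left_comm (N.lam j _), ← Finset.mul_sum]
            exact mul_le_mul_of_nonneg_left (hsamp j i₀ hj1 _) (norm_nonneg _)
        _ = _ := by rw [integral_mul_const]
    have hU : ∀ k, ‖N.coeff (fun θ => C₀ + (trigSum L c θ).re) j k‖ ≤
        D * ((E + 1) * A) * y⁻¹ := by
      intro k
      refine (N.norm_coeff_le L c C₀ j k).trans ?_
      calc _ ≤ (D * y⁻¹) * (E * A) :=
            mul_le_mul (hlam j k).1 (hsup' _) (norm_nonneg _) (by positivity)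
        _ ≤ (D * y⁻¹) * ((E + 1) * A) := by gcongr; linarith
        _ = _ := by ring
    have hV : ∑ k, ‖N.coeff (fun θ => C₀ + (trigSum L c θ).re) j k‖ ≤
        D * ((E + 1) * A) * W * y := by
      calc _ ≤ ∑ k, (D * y) * (N.lam j k *
              ‖trigSum L (fun i => (N.b (freqNorm (L i) / N.B ^ j) : ℂ) * c i) (N.ξ j k)‖) := by
            refine Finset.sum_le_sum fun k _ => (N.norm_coeff_le L c C₀ j k).trans ?_
            rw [← mul_assoc]
            exact mul_le_mul_of_nonneg_right (hlam j k).2 (norm_nonneg _)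
        _ ≤ (D * y) * (E * (A * W)) := by
            rw [← Finset.mul_sum]
            exact mul_le_mul_of_nonneg_left hsum' (by positivity)
        _ ≤ (D * y) * ((E + 1) * (A * W)) := by gcongr; linarith
        _ = _ := by ring
    refine (mul_le_mul_right (eLpNorm_count_le_of_sum_le _ (by positivity) (by positivity) hU hV
      hr) _).trans ?_
    rw [← ENNReal.ofReal_mul (by positivity)]
    refine ENNReal.ofReal_le_ofReal ?_
    set X := D * ((E + 1) * A) with hX
    have hX0 : 0 ≤ X := by positivity
    have h1 : (X * y⁻¹) ^ (1 - ϱ) * (X * W * y) ^ ϱ = X * W ^ ϱ * y ^ (2 * ϱ - 1) := by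
      rcases hX0.eq_or_lt with h0 | h0
      · rw [← h0]
        rcases eq_or_ne ϱ 0 with h2 | h2
        · simp [h2]
        · simp [Real.zero_rpow h2]
      rw [Real.mul_rpow hX0 (by positivity), Real.mul_rpow (by positivity) hy0.le,
        Real.mul_rpow hX0 hW, Real.inv_rpow hy0.le, ← Real.rpow_neg hy0.le,
        show 2 * ϱ - 1 = -(1 - ϱ) + ϱ by ring, Real.rpow_add hy0]
      have h3 : X ^ (1 - ϱ) * X ^ ϱ = X := by
        rw [← Real.rpow_add h0, sub_add_cancel, Real.rpow_one]
      linear_combination (y ^ (-(1 - ϱ)) * W ^ ϱ * y ^ ϱ) * h3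
    have h2 : N.B ^ ((j : ℝ) * (t + d * (1 / 2 - ϱ))) * y ^ (2 * ϱ - 1) = (N.B ^ j) ^ t := by
      rw [hy, ← Real.rpow_mul hB.le, ← Real.rpow_add hB, ← Real.rpow_natCast,
        ← Real.rpow_mul hB.le]
      congr 1
      ring
    have h3 : (N.B ^ j) ^ t ≤ (N.B * (4 * d)) ^ t * R ^ t := by
      rw [← Real.mul_rpow (by positivity) hR.le]
      refine Real.rpow_le_rpow (by positivity) ?_ ht
      calc N.B ^ j ≤ N.B * freqNorm (L i₀) := hj2
        _ ≤ N.B * (4 * d * R) := by gcongr; exact hhigh i₀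
        _ = _ := by ring
    calc _ = X * W ^ ϱ * (N.B ^ ((j : ℝ) * (t + d * (1 / 2 - ϱ))) * y ^ (2 * ϱ - 1)) := by
          rw [h1]; ring
      _ ≤ X * W ^ ϱ * ((N.B * (4 * d)) ^ t * R ^ t) := by
          rw [h2]
          gcongr
      _ = _ := by rw [hX]; ring
  have hzero : ∀ j : ℕ, (¬ ∃ i, N.b (freqNorm (L i) / N.B ^ j) ≠ 0) →
      ENNReal.ofReal (N.B ^ ((j : ℝ) * (t + d * (1 / 2 - ϱ)))) *
        eLpNorm (fun k : Fin (N.K j) => N.coeff (fun θ => C₀ + (trigSum L c θ).re) j k) r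
          Measure.count = 0 := by
    intro j hj
    push Not at hj
    have : (fun k : Fin (N.K j) => N.coeff (fun θ => C₀ + (trigSum L c θ).re) j k) = 0 := by
      funext k
      have := N.norm_coeff_le L c C₀ j k
      simp only [hj, Complex.ofReal_zero, zero_mul, trigSum, Finset.sum_const_zero, norm_zero,
        mul_zero] at this
      exact norm_le_zero_iff.mp this
    rw [this, eLpNorm_zero, mul_zero]
  obtain ⟨J, hJcard, hJ⟩ := hn₀ R hR
  refine (eLpNorm_count_le_of_finset _ J
    (X := ENNReal.ofReal (D * (E + 1) * (N.B * (4 * d)) ^ t * (R ^ t * A * W ^ ϱ)))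
    (fun j => ?_) (fun j hj => ?_) q).trans ?_
  · by_cases h : ∃ i, N.b (freqNorm (L i) / N.B ^ j) ≠ 0
    · exact hlevel j h
    · exact (hzero j h).trans_le zero_le
  · refine hzero j ?_
    rintro ⟨i, hi⟩
    obtain ⟨h1, h2⟩ := N.le_of_b_ne_zero hi
    exact hj (hJ j ((hlow i).trans h1)
      (h2.trans (mul_le_mul_of_nonneg_left (hhigh i) hB.le)))
  · have h1 : ((J.card : ℝ≥0∞)) ^ q.toReal⁻¹ ≤ ENNReal.ofReal (((n₀ : ℝ) + 1) ^ q.toReal⁻¹) := by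
      rw [← ENNReal.ofReal_rpow_of_nonneg (by positivity) (by positivity)]
      refine ENNReal.rpow_le_rpow ?_ (by positivity)
      rw [← ENNReal.ofReal_natCast]
      refine ENNReal.ofReal_le_ofReal ?_
      have : (J.card : ℝ) ≤ n₀ := by exact_mod_cast hJcard
      linarith
    refine (mul_le_mul_right h1 _).trans (le_of_eq ?_)
    rw [← ENNReal.ofReal_mul (by positivity)]
    congr 1
    ring

end NeedletSystem

end

section

/-! ### Testing two product measures -/

section TwoPoint

variable {α : Type*} [MeasurableSpace α] {μ : Measure α}

lemma pi_withDensity_ofReal [SigmaFinite μ] (n : ℕ) {f : α → ℝ} (hf : Integrable f μ)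
    (hf0 : ∀ x, 0 ≤ f x) :
    Measure.pi (fun _ : Fin n => μ.withDensity fun x => ENNReal.ofReal (f x)) =
      (Measure.pi fun _ : Fin n => μ).withDensity
        fun x => ENNReal.ofReal (∏ i, f (x i)) := by
  have : IsFiniteMeasure (μ.withDensity fun x => ENNReal.ofReal (f x)) :=
    isFiniteMeasure_withDensity_ofReal hf.2
  refine Measure.pi_eq fun s hs => ?_
  rw [withDensity_apply _ (MeasurableSet.univ_pi hs), Measure.restrict_pi_pi,
    ← ofReal_integral_eq_lintegral_ofReal
      (Integrable.fintype_prod_dep (f := fun _ => f) fun i => hf.restrict)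
      (.of_forall fun x => Finset.prod_nonneg fun i _ => hf0 _),
    integral_fintype_prod_eq_prod (f := fun _ => f),
    ENNReal.ofReal_prod_of_nonneg fun i _ => integral_nonneg hf0]
  refine Finset.prod_congr rfl fun i _ => ?_
  rw [withDensity_apply _ (hs i),
    ofReal_integral_eq_lintegral_ofReal hf.restrict (.of_forall hf0)]

/-- The affinity of two densities that are bounded below is controlled by their `L²` distance. -/
lemma one_sub_le_integral_sqrt_mul {f g : α → ℝ} {a : ℝ} (ha : 0 < a) (hf : ∀ x, a ≤ f x)
    (hg : ∀ x, a ≤ g x) (hfi : Integrable f μ) (hgi : Integrable g μ) (hf1 : ∫ x, f x ∂μ = 1)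
    (hg1 : ∫ x, g x ∂μ = 1) (hsq : Integrable (fun x => (f x - g x) ^ 2) μ)
    (hsqrt : Integrable (fun x => Real.sqrt (f x * g x)) μ) :
    1 - (∫ x, (f x - g x) ^ 2 ∂μ) / (8 * a) ≤ ∫ x, Real.sqrt (f x * g x) ∂μ := by
  have hpt : ∀ x, (f x + g x) / 2 - (f x - g x) ^ 2 / (8 * a) ≤ Real.sqrt (f x * g x) := by
    intro x
    have hfx := ha.trans_le (hf x)
    have hgx := ha.trans_le (hg x)
    rw [Real.sqrt_mul hfx.le]
    have h1 := Real.sqrt_le_sqrt (hf x)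
    have h2 := Real.sqrt_le_sqrt (hg x)
    have e1 := Real.sq_sqrt hfx.le
    have e2 := Real.sq_sqrt hgx.le
    have e3 := Real.sq_sqrt ha.le
    have h0 := Real.sqrt_nonneg a
    set p := Real.sqrt (f x)
    set q := Real.sqrt (g x)
    set w := Real.sqrt a
    rw [← e1, ← e2]
    have h4 : 4 * a ≤ (p + q) ^ 2 := by
      rw [← e3]
      nlinarith
    have h5 : (p - q) ^ 2 / 2 ≤ (p ^ 2 - q ^ 2) ^ 2 / (8 * a) := by
      rw [div_le_div_iff₀ (by norm_num) (by positivity)]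
      nlinarith [mul_le_mul_of_nonneg_left h4 (sq_nonneg (p - q))]
    nlinarith
  have hmean : Integrable (fun x => (f x + g x) / 2) μ := (hfi.add hgi).div_const 2
  have hpen : Integrable (fun x => (f x - g x) ^ 2 / (8 * a)) μ := hsq.div_const _
  calc 1 - (∫ x, (f x - g x) ^ 2 ∂μ) / (8 * a)
      = ∫ x, ((f x + g x) / 2 - (f x - g x) ^ 2 / (8 * a)) ∂μ := by
        rw [integral_sub hmean hpen, integral_div,
          integral_div, integral_add hfi hgi, hf1, hg1]
        norm_num
    _ ≤ _ := integral_mono (hmean.sub hpen) hsqrt hpt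

/-- **Le Cam's two-point bound** for product measures: two losses that never are small
simultaneously cannot both have small expectation if the affinity of the two densities is close
to one. -/
lemma le_lintegral_add_lintegral_pi [SigmaFinite μ] {n : ℕ} {f g : α → ℝ} (hfi : Integrable f μ)
    (hgi : Integrable g μ) (hfm : Measurable f) (hgm : Measurable g) (hf : ∀ x, 0 ≤ f x)
    (hg : ∀ x, 0 ≤ g x) (hf1 : ∫ x, f x ∂μ = 1)
    (hg1 : ∫ x, g x ∂μ = 1) (hsqrt : Integrable (fun x => Real.sqrt (f x * g x)) μ)
    (haff : 1 / 2 ≤ (∫ x, Real.sqrt (f x * g x) ∂μ) ^ n) {u v : (Fin n → α) → ℝ≥0∞}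
    (hu : Measurable u) (hv : Measurable v) {δ : ℝ≥0∞} (hδ : ∀ x, δ ≤ u x + v x) :
    δ * ENNReal.ofReal (1 / 8) ≤
      ∫⁻ x, u x ∂(Measure.pi fun _ : Fin n => μ.withDensity fun x => ENNReal.ofReal (f x)) +
      ∫⁻ x, v x ∂(Measure.pi fun _ : Fin n => μ.withDensity fun x => ENNReal.ofReal (g x)) := by
  rw [pi_withDensity_ofReal n hfi hf, pi_withDensity_ofReal n hgi hg]
  set π := Measure.pi fun _ : Fin n => μ
  set F : (Fin n → α) → ℝ := fun x => ∏ i, f (x i) with hF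
  set H : (Fin n → α) → ℝ := fun x => ∏ i, g (x i) with hH
  have hFm : Measurable F := Finset.measurable_prod _ fun i _ => hfm.comp (measurable_pi_apply i)
  have hHm : Measurable H := Finset.measurable_prod _ fun i _ => hgm.comp (measurable_pi_apply i)
  have hF0 : ∀ x, 0 ≤ F x := fun x => Finset.prod_nonneg fun i _ => hf _
  have hH0 : ∀ x, 0 ≤ H x := fun x => Finset.prod_nonneg fun i _ => hg _
  have hFi : Integrable F π := Integrable.fintype_prod (f := fun _ => f) fun _ => hfi
  have hHi : Integrable H π := Integrable.fintype_prod (f := fun _ => g) fun _ => hgi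
  have hF1 : ∫ x, F x ∂π = 1 := by
    rw [hF, integral_fintype_prod_eq_prod (f := fun _ => f)]
    simp [hf1]
  have hH1 : ∫ x, H x ∂π = 1 := by
    rw [hH, integral_fintype_prod_eq_prod (f := fun _ => g)]
    simp [hg1]
  have hmin : Integrable (fun x => min (F x) (H x)) π := hFi.inf hHi
  -- `√(ab) ≤ 2 min(a, b) + (a + b) / 8` turns the affinity into a bound for the overlap
  have hover : 1 / 8 ≤ ∫ x, min (F x) (H x) ∂π := by
    have hpt : ∀ x : Fin n → α, ∏ i, Real.sqrt (f (x i) * g (x i)) ≤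
        2 * min (F x) (H x) + (F x + H x) / 8 := by
      intro x
      have hsq : (∏ i, Real.sqrt (f (x i) * g (x i))) ^ 2 = F x * H x := by
        rw [← Finset.prod_pow, hF, hH, ← Finset.prod_mul_distrib]
        exact Finset.prod_congr rfl fun i _ => Real.sq_sqrt (mul_nonneg (hf _) (hg _))
      have h1 := hF0 x
      have h2 := hH0 x
      rcases le_total (F x) (H x) with h | h
      · rw [min_eq_left h]
        refine (sq_le_sq₀ (Finset.prod_nonneg fun i _ => Real.sqrt_nonneg _) (by positivity)).mp ?_
        rw [hsq]
        nlinarith [sq_nonneg (2 * F x - H x / 8), mul_nonneg h1 h2, sq_nonneg (F x)]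
      · rw [min_eq_right h]
        refine (sq_le_sq₀ (Finset.prod_nonneg fun i _ => Real.sqrt_nonneg _) (by positivity)).mp ?_
        rw [hsq]
        nlinarith [sq_nonneg (2 * H x - F x / 8), mul_nonneg h1 h2, sq_nonneg (H x)]
    have hprod : ∫ x : Fin n → α, ∏ i, Real.sqrt (f (x i) * g (x i)) ∂π =
        (∫ x, Real.sqrt (f x * g x) ∂μ) ^ n := by
      rw [integral_fintype_prod_eq_prod (f := fun _ x => Real.sqrt (f x * g x))]
      simp
    have hmin2 : Integrable (fun x => 2 * min (F x) (H x)) π := hmin.const_mul 2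
    have hmean : Integrable (fun x => (F x + H x) / 8) π := (hFi.add hHi).div_const 8
    have h3 := integral_mono
      (Integrable.fintype_prod (f := fun _ x => Real.sqrt (f x * g x)) fun _ : Fin n => hsqrt)
      (hmin2.add hmean) hpt
    simp only [Pi.add_apply] at h3
    rw [hprod, integral_add hmin2 hmean, integral_const_mul,
      integral_div, integral_add hFi hHi, hF1, hH1] at h3
    linarith
  rw [lintegral_withDensity_eq_lintegral_mul _ hFm.ennreal_ofReal hu,
    lintegral_withDensity_eq_lintegral_mul _ hHm.ennreal_ofReal hv,
    ← lintegral_add_left (hFm.ennreal_ofReal.mul hu)]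
  calc δ * ENNReal.ofReal (1 / 8) ≤ δ * ENNReal.ofReal (∫ x, min (F x) (H x) ∂π) := by gcongr
    _ = ∫⁻ x, δ * ENNReal.ofReal (min (F x) (H x)) ∂π := by
        rw [ofReal_integral_eq_lintegral_ofReal hmin
          (.of_forall fun x => le_min (hF0 x) (hH0 x)),
          lintegral_const_mul _ (hFm.min hHm).ennreal_ofReal]
    _ ≤ _ := by
        refine lintegral_mono fun x => ?_
        calc δ * ENNReal.ofReal (min (F x) (H x))
            ≤ (u x + v x) * ENNReal.ofReal (min (F x) (H x)) := by gcongr; exact hδ x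
          _ = ENNReal.ofReal (min (F x) (H x)) * u x +
              ENNReal.ofReal (min (F x) (H x)) * v x := by ring
          _ ≤ _ := by
              simp only [Pi.mul_apply]
              gcongr
              · exact min_le_left _ _
              · exact min_le_right _ _

end TwoPoint

/-! ### The loss on a cell -/

variable {d n : ℕ}

/-- The expected `e`-th power loss of an estimator of `D` on a set `S`, under the density `f`. -/
def localRisk (e : ℝ) (S : Set (Fin d → ℝ)) (fhat : Estimator d n) (f D : (Fin d → ℝ) → ℝ) :
    ℝ≥0∞ :=
  ∫⁻ x, ∫⁻ θ in S, ‖fhat.toFun x θ - D θ‖ₑ ^ e ∂(rho d) ∂(sampleLaw n f)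

lemma measurable_enorm_sub_rpow (e : ℝ) (fhat : Estimator d n) {D : (Fin d → ℝ) → ℝ}
    (hD : Measurable D) :
    Measurable fun z : (Fin n → (Fin d → ℝ)) × (Fin d → ℝ) =>
      ‖fhat.toFun z.1 z.2 - D z.2‖ₑ ^ e :=
  ((fhat.measurable_toFun.sub (hD.comp measurable_snd)).enorm).pow_const e

lemma le_localRisk_add_localRisk {e : ℝ} (he : 1 ≤ e) {S : Set (Fin d → ℝ)}
    (hS : MeasurableSet S) (fhat : Estimator d n) {f g D D' : (Fin d → ℝ) → ℝ}
    (hD : Measurable D) (hD' : Measurable D')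
    (hfi : Integrable f (rho d)) (hgi : Integrable g (rho d)) (hfm : Measurable f)
    (hgm : Measurable g) (hf : ∀ x, 0 ≤ f x)
    (hg : ∀ x, 0 ≤ g x) (hf1 : ∫ x, f x ∂(rho d) = 1) (hg1 : ∫ x, g x ∂(rho d) = 1)
    (hsqrt : Integrable (fun x => Real.sqrt (f x * g x)) (rho d))
    (haff : 1 / 2 ≤ (∫ x, Real.sqrt (f x * g x) ∂(rho d)) ^ n) {h : ℝ} (hh : 0 ≤ h)
    (hsep : ∀ θ ∈ S, h ≤ |D θ - D' θ|) :
    ENNReal.ofReal (2 ^ (1 - e) / 8 * h ^ e) * rho d S ≤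
      localRisk e S fhat f D + localRisk e S fhat g D' := by
  have hu := (measurable_enorm_sub_rpow e fhat hD).lintegral_prod_right' (ν := (rho d).restrict S)
  have hv := (measurable_enorm_sub_rpow e fhat hD').lintegral_prod_right' (ν := (rho d).restrict S)
  have key : ∀ x, ENNReal.ofReal (2 ^ (1 - e) * h ^ e) * rho d S ≤
      (∫⁻ θ in S, ‖fhat.toFun x θ - D θ‖ₑ ^ e ∂(rho d)) +
        ∫⁻ θ in S, ‖fhat.toFun x θ - D' θ‖ₑ ^ e ∂(rho d) := by
    intro x
    have hm : Measurable fun θ => ‖fhat.toFun x θ - D θ‖ₑ ^ e :=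
      (measurable_enorm_sub_rpow e fhat hD).comp measurable_prodMk_left
    rw [← lintegral_add_left hm, ← setLIntegral_const]
    refine setLIntegral_mono' hS fun θ hθ => ?_
    set a := fhat.toFun x θ - D θ
    set b := fhat.toFun x θ - D' θ
    have hab : ENNReal.ofReal h ≤ ‖a‖ₑ + ‖b‖ₑ := by
      calc ENNReal.ofReal h ≤ ENNReal.ofReal ‖b - a‖ := by
            refine ENNReal.ofReal_le_ofReal ((hsep θ hθ).trans (le_of_eq ?_))
            rw [Real.norm_eq_abs]
            congr 1
            ring
        _ = ‖b - a‖ₑ := ofReal_norm _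
        _ ≤ ‖b‖ₑ + ‖a‖ₑ := enorm_sub_le
        _ = _ := add_comm _ _
    have h1 : ENNReal.ofReal (h ^ e) ≤ 2 ^ (e - 1) * (‖a‖ₑ ^ e + ‖b‖ₑ ^ e) := by
      rw [← ENNReal.ofReal_rpow_of_nonneg hh (by linarith)]
      exact (ENNReal.rpow_le_rpow hab (by linarith)).trans
        (ENNReal.rpow_add_le_mul_rpow_add_rpow _ _ he)
    calc ENNReal.ofReal (2 ^ (1 - e) * h ^ e)
        = ENNReal.ofReal (2 ^ (1 - e)) * ENNReal.ofReal (h ^ e) :=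
          ENNReal.ofReal_mul (by positivity)
      _ ≤ ENNReal.ofReal (2 ^ (1 - e)) * (2 ^ (e - 1) * (‖a‖ₑ ^ e + ‖b‖ₑ ^ e)) := by gcongr
      _ = ‖a‖ₑ ^ e + ‖b‖ₑ ^ e := by
          have h2 : (2 : ℝ≥0∞) ^ (e - 1) = ENNReal.ofReal (2 ^ (e - 1)) := by
            rw [← ENNReal.ofReal_rpow_of_pos two_pos, ENNReal.ofReal_ofNat]
          rw [h2, ← mul_assoc, ← ENNReal.ofReal_mul (by positivity), ← Real.rpow_add two_pos]
          simp
  have := le_lintegral_add_lintegral_pi (n := n) hfi hgi hfm hgm hf hg hf1 hg1 hsqrt haff hu hv key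
  refine le_trans (le_of_eq ?_) this
  rw [mul_right_comm, ← ENNReal.ofReal_mul (by positivity)]
  congr 2
  ring

lemma sum_localRisk_le_risk {ι : Type*} (s : Finset ι) {S : ι → Set (Fin d → ℝ)}
    (hS : ∀ i ∈ s, MeasurableSet (S i)) (hdisj : Set.PairwiseDisjoint (s : Set ι) S)
    (m : Fin d → ℕ) {p : ℝ≥0∞} (hp : 1 ≤ p) (hp' : p ≠ ⊤) (fhat : Estimator d n)
    {f : (Fin d → ℝ) → ℝ} (hD : Measurable (multiDeriv m f)) :
    ∑ i ∈ s, localRisk p.toReal (S i) fhat f (multiDeriv m f) ≤ risk m p fhat f := by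
  have hp0 : p ≠ 0 := (zero_lt_one.trans_le hp).ne'
  simp only [localRisk]
  rw [← lintegral_finsetSum _ fun i _ =>
    (measurable_enorm_sub_rpow p.toReal fhat hD).lintegral_prod_right', risk, if_neg hp']
  refine lintegral_mono fun x => ?_
  rw [eLpNorm_eq_lintegral_rpow_enorm_toReal hp0 hp', ← ENNReal.rpow_mul,
    one_div_mul_cancel (ENNReal.toReal_pos hp0 hp').ne', ENNReal.rpow_one,
    ← lintegral_biUnion_finset hdisj hS]
  exact setLIntegral_le_lintegral _ _

lemma localRisk_one_le_risk_top (S : Set (Fin d → ℝ)) (m : Fin d → ℕ) (fhat : Estimator d n)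
    (f : (Fin d → ℝ) → ℝ) :
    localRisk 1 S fhat f (multiDeriv m f) ≤ risk m ⊤ fhat f * rho d S := by
  have hfin : rho d S ≠ ⊤ := measure_ne_top _ _
  simp only [localRisk, risk, if_true, ENNReal.rpow_one, eLpNorm_exponent_top]
  rw [← lintegral_mul_const' _ _ hfin]
  refine lintegral_mono fun x => ?_
  rw [← setLIntegral_const]
  exact lintegral_mono_ae (ae_restrict_of_ae (enorm_ae_le_eLpNormEssSup _ _))

end

section

variable {d R : ℕ}

/-! ### Perturbed uniform densities -/

/-- The uniform density perturbed by wave packets at the grid points with weights `ε`. -/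
def packetDensity (R M : ℕ) (γ : ℝ) (ε : (Fin d → Fin R) → ℝ) : (Fin d → ℝ) → ℝ :=
  fun θ => ((2 * Real.pi) ^ d)⁻¹ + (trigSum (pairFreq R) (packetCoeff R M γ ε) θ).re

lemma contDiff_packetDensity (M : ℕ) (γ : ℝ) (ε : (Fin d → Fin R) → ℝ) {k : WithTop ℕ∞} :
    ContDiff ℝ k (packetDensity R M γ ε) :=
  contDiff_const.add (Complex.reCLM.contDiff.comp (contDiff_trigSum _ _))

lemma continuous_packetDensity (M : ℕ) (γ : ℝ) (ε : (Fin d → Fin R) → ℝ) :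
    Continuous (packetDensity R M γ ε) :=
  (contDiff_packetDensity M γ ε (k := 0)).continuous

lemma measurable_multiDeriv_packetDensity (m : Fin d → ℕ) (M : ℕ) (γ : ℝ)
    (ε : (Fin d → Fin R) → ℝ) : Measurable (multiDeriv m (packetDensity R M γ ε)) :=
  (continuous_multiDeriv_const_add_re_trigSum _ _ m _).measurable

lemma expChar_single_two_pi (l : Fin d → ℤ) (i : Fin d) :
    expChar l (Pi.single i (2 * Real.pi)) = 1 := by
  have h : (Pi.single i (2 * Real.pi) : Fin d → ℝ) =
      (2 * Real.pi) • Pi.single i (1 : ℝ) := by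
    rw [← Pi.single_smul]
    simp
  rw [h, expChar_smul_single, Complex.exp_eq_one_iff]
  exact ⟨l i, by push_cast; ring⟩

lemma isPeriodic_packetDensity (M : ℕ) (γ : ℝ) (ε : (Fin d → Fin R) → ℝ) :
    IsPeriodic (packetDensity R M γ ε) := by
  intro i θ
  simp only [packetDensity, trigSum_add, expChar_single_two_pi, mul_one]

lemma abs_packetDensity_sub_le (M : ℕ) {γ : ℝ} (hγ : 0 ≤ γ) {ε : (Fin d → Fin R) → ℝ}
    (hε : ∀ τ, |ε τ| ≤ 1) (θ : Fin d → ℝ) :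
    |packetDensity R M γ ε θ - ((2 * Real.pi) ^ d)⁻¹| ≤ γ * (R : ℝ) ^ (2 * d) := by
  rw [packetDensity, add_sub_cancel_left]
  exact (Complex.abs_re_le_norm _).trans (norm_trigSum_packetCoeff_le M hγ hε θ)

lemma le_packetDensity (M : ℕ) {γ : ℝ} (hγ : 0 ≤ γ)
    (hA : γ * (R : ℝ) ^ (2 * d) ≤ ((2 * Real.pi) ^ d)⁻¹ / 2) {ε : (Fin d → Fin R) → ℝ}
    (hε : ∀ τ, |ε τ| ≤ 1) (θ : Fin d → ℝ) :
    ((2 * Real.pi) ^ d)⁻¹ / 2 ≤ packetDensity R M γ ε θ := by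
  have := (abs_le.mp (abs_packetDensity_sub_le M hγ hε θ)).1
  linarith

lemma packetDensity_le (M : ℕ) {γ : ℝ} (hγ : 0 ≤ γ)
    (hA : γ * (R : ℝ) ^ (2 * d) ≤ ((2 * Real.pi) ^ d)⁻¹ / 2) {ε : (Fin d → Fin R) → ℝ}
    (hε : ∀ τ, |ε τ| ≤ 1) (θ : Fin d → ℝ) :
    packetDensity R M γ ε θ ≤ 2 * ((2 * Real.pi) ^ d)⁻¹ := by
  have := (abs_le.mp (abs_packetDensity_sub_le M hγ hε θ)).2
  have : 0 < ((2 * Real.pi) ^ d)⁻¹ := by have := Real.pi_pos; positivity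
  linarith

lemma integrable_packetDensity (M : ℕ) (γ : ℝ) (ε : (Fin d → Fin R) → ℝ) :
    Integrable (packetDensity R M γ ε) (rho d) := by
  refine integrable_of_continuous_bounded (continuous_packetDensity M γ ε)
    (C := ‖((2 * Real.pi) ^ d)⁻¹‖ + ∑ ab, ‖packetCoeff R M γ ε ab‖) fun θ => ?_
  refine (norm_add_le _ _).trans (add_le_add_right ?_ _)
  exact (Complex.abs_re_le_norm _).trans (norm_trigSum_le _ _ θ)

lemma integral_packetDensity (hd : 0 < d) (hR : 0 < R) (M : ℕ) (γ : ℝ)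
    (ε : (Fin d → Fin R) → ℝ) : ∫ θ, packetDensity R M γ ε θ ∂(rho d) = 1 := by
  have hint : Integrable (trigSum (pairFreq R) (packetCoeff R M γ ε)) (rho d) :=
    integrable_of_continuous_bounded (continuous_trigSum _ _) (norm_trigSum_le _ _)
  have hzero : ∫ θ, trigSum (pairFreq R) (packetCoeff R M γ ε) θ ∂(rho d) = 0 := by
    simp only [trigSum]
    rw [integral_finsetSum _ fun ab _ => (integrable_of_continuous_bounded
      (continuous_expChar _) fun x => (norm_expChar _ x).le).const_mul _]
    refine Finset.sum_eq_zero fun ab _ => ?_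
    have hne : pairFreq R ab ≠ 0 := by
      intro h
      have h1 := le_pairFreq ab ⟨0, hd⟩
      have hR' : (0 : ℝ) < R := by exact_mod_cast hR
      rw [h] at h1
      simp only [Pi.zero_apply, Int.cast_zero] at h1
      linarith
    rw [integral_const_mul, integral_expChar, if_neg hne, mul_zero]
  have hre : ∫ θ, (trigSum (pairFreq R) (packetCoeff R M γ ε) θ).re ∂(rho d) = 0 := by
    have := integral_re hint
    simp only [RCLike.re_eq_complex_re] at this
    rw [this, hzero, Complex.zero_re]
  simp only [packetDensity]
  have hint' : Integrable (fun θ => (trigSum (pairFreq R) (packetCoeff R M γ ε) θ).re) (rho d) :=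
    hint.re
  rw [integral_add (integrable_const _) hint', hre, integral_const, measureReal_def, rho_univ,
    ENNReal.toReal_ofReal (by have := Real.pi_pos; positivity), smul_eq_mul, add_zero]
  exact mul_inv_cancel₀ (by have := Real.pi_pos; positivity)

lemma norm_blockSum_sq_le (θ : Fin d → ℝ) : ‖blockSum R θ‖ ^ 2 ≤ (R : ℝ) ^ (2 * d) := by
  have h : ‖blockSum R θ‖ ≤ (R : ℝ) ^ d := by
    refine (norm_trigSum_le _ _ θ).trans (le_of_eq ?_)
    simp
  calc ‖blockSum R θ‖ ^ 2 ≤ ((R : ℝ) ^ d) ^ 2 := pow_le_pow_left₀ (norm_nonneg _) h 2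
    _ = _ := by rw [← pow_mul, mul_comm]

lemma sq_packetDensity_sub_le (M : ℕ) {γ : ℝ} {ε ε' : (Fin d → Fin R) → ℝ}
    {τ : Fin d → Fin R} (hτ : ε τ - ε' τ = 2) (hne : ∀ σ, σ ≠ τ → ε σ = ε' σ) (θ : Fin d → ℝ) :
    (packetDensity R M γ ε θ - packetDensity R M γ ε' θ) ^ 2 ≤
      4 * γ ^ 2 * (R : ℝ) ^ (2 * d) * ‖blockSum R (θ + -gridPoint R τ)‖ ^ 2 := by
  have h1 : packetDensity R M γ ε θ - packetDensity R M γ ε' θ =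
      ((γ : ℂ) * (-Complex.I) ^ M * (2 * blockSum R (θ + -gridPoint R τ) ^ 2)).re := by
    rw [packetDensity, packetDensity, add_sub_add_left_eq_sub, ← Complex.sub_re,
      trigSum_packetCoeff, trigSum_packetCoeff, ← mul_sub, ← Finset.sum_sub_distrib,
      Finset.sum_eq_single τ, ← sub_mul, sub_eq_add_neg θ]
    · have : (ε τ : ℂ) - ε' τ = 2 := by exact_mod_cast hτ
      rw [this]
    · intro σ _ hσ
      rw [hne σ hσ, sub_self]
    · simp
  set z := blockSum R (θ + -gridPoint R τ) with hz
  have h2 : |packetDensity R M γ ε θ - packetDensity R M γ ε' θ| ≤ 2 * |γ| * ‖z‖ ^ 2 := by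
    rw [h1]
    refine (Complex.abs_re_le_norm _).trans (le_of_eq ?_)
    rw [norm_mul, norm_mul, norm_phase, norm_mul, norm_pow, Complex.norm_real, Real.norm_eq_abs]
    simp only [Complex.norm_ofNat]
    ring
  calc (packetDensity R M γ ε θ - packetDensity R M γ ε' θ) ^ 2
      = |packetDensity R M γ ε θ - packetDensity R M γ ε' θ| ^ 2 := (sq_abs _).symm
    _ ≤ (2 * |γ| * ‖z‖ ^ 2) ^ 2 := pow_le_pow_left₀ (abs_nonneg _) h2 2
    _ = 4 * γ ^ 2 * ‖z‖ ^ 2 * ‖z‖ ^ 2 := by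
        rw [← sq_abs γ]
        ring
    _ ≤ _ := by
        gcongr
        exact norm_blockSum_sq_le _

/-- The expected losses, on the cell of a grid point, of two densities that differ only in the
packet at this point. -/
lemma le_localRisk_packetDensity (hd : 0 < d) (hR : 0 < R) (m : Fin d → ℕ) {n : ℕ} {γ : ℝ}
    (hγ : 0 ≤ γ) (hA : γ * (R : ℝ) ^ (2 * d) ≤ ((2 * Real.pi) ^ d)⁻¹ / 2)
    (hn : n * (γ ^ 2 * (R : ℝ) ^ (3 * d) * ((2 * Real.pi) ^ d) ^ 2) ≤ 1 / 2)
    {ε ε' : (Fin d → Fin R) → ℝ} (hε : ∀ τ, |ε τ| ≤ 1) (hε' : ∀ τ, |ε' τ| ≤ 1)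
    {τ : Fin d → Fin R} (hτ : ε τ - ε' τ = 2) (hne : ∀ σ, σ ≠ τ → ε σ = ε' σ)
    (fhat : Estimator d n) {e : ℝ} (he : 1 ≤ e) :
    ENNReal.ofReal (2 ^ (1 - e) / 8 * (γ * (R : ℝ) ^ (2 * d) * (R : ℝ) ^ order m) ^ e) *
        rho d (cell d R τ) ≤
      localRisk e (cell d R τ) fhat (packetDensity R (order m) γ ε)
        (multiDeriv m (packetDensity R (order m) γ ε)) +
      localRisk e (cell d R τ) fhat (packetDensity R (order m) γ ε')
        (multiDeriv m (packetDensity R (order m) γ ε')) := by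
  set f := packetDensity R (order m) γ ε with hf
  set g := packetDensity R (order m) γ ε' with hg
  set V : ℝ := (2 * Real.pi) ^ d with hV
  have hV0 : 0 < V := by have := Real.pi_pos; positivity
  have hfc : Continuous f := continuous_packetDensity _ _ _
  have hgc : Continuous g := continuous_packetDensity _ _ _
  have hf0 : ∀ x, V⁻¹ / 2 ≤ f x := le_packetDensity _ hγ hA hε
  have hg0 : ∀ x, V⁻¹ / 2 ≤ g x := le_packetDensity _ hγ hA hε'
  have hf2 : ∀ x, f x ≤ 2 * V⁻¹ := packetDensity_le _ hγ hA hε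
  have hg2 : ∀ x, g x ≤ 2 * V⁻¹ := packetDensity_le _ hγ hA hε'
  have hpos : 0 < V⁻¹ / 2 := by positivity
  have hfi : Integrable f (rho d) := integrable_packetDensity _ _ _
  have hgi : Integrable g (rho d) := integrable_packetDensity _ _ _
  have hf1 : ∫ x, f x ∂(rho d) = 1 := integral_packetDensity hd hR _ _ _
  have hg1 : ∫ x, g x ∂(rho d) = 1 := integral_packetDensity hd hR _ _ _
  have hsqrt : Integrable (fun x => Real.sqrt (f x * g x)) (rho d) := by
    refine integrable_of_continuous_bounded (C := Real.sqrt ((2 * V⁻¹) * (2 * V⁻¹)))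
      (hfc.mul hgc).sqrt fun x => ?_
    rw [Real.norm_of_nonneg (Real.sqrt_nonneg _)]
    exact Real.sqrt_le_sqrt (mul_le_mul (hf2 x) (hg2 x) (hpos.le.trans (hg0 x)) (by positivity))
  have hblock : Integrable (fun θ => ‖blockSum R (θ + -gridPoint R τ)‖ ^ 2) (rho d) := by
    refine integrable_of_continuous_bounded (C := (R : ℝ) ^ (2 * d))
      ((continuous_blockSum.comp (continuous_id.add continuous_const)).norm.pow 2) fun x => ?_
    rw [Real.norm_of_nonneg (sq_nonneg _)]
    exact norm_blockSum_sq_le _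
  have hsqle := sq_packetDensity_sub_le (order m) (γ := γ) hτ hne
  have hsq : Integrable (fun x => (f x - g x) ^ 2) (rho d) := by
    refine (hblock.const_mul (4 * γ ^ 2 * (R : ℝ) ^ (2 * d))).mono'
      ((hfc.sub hgc).pow 2).aestronglyMeasurable (.of_forall fun x => ?_)
    rw [Real.norm_of_nonneg (sq_nonneg _)]
    exact hsqle x
  have hsqint : ∫ x, (f x - g x) ^ 2 ∂(rho d) ≤
      4 * γ ^ 2 * (R : ℝ) ^ (2 * d) * (V * (R : ℝ) ^ d) := by
    refine (integral_mono hsq (hblock.const_mul _) hsqle).trans (le_of_eq ?_)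
    rw [integral_const_mul, integral_sq_norm_blockSum]
  have haff : 1 / 2 ≤ (∫ x, Real.sqrt (f x * g x) ∂(rho d)) ^ n := by
    have h1 := one_sub_le_integral_sqrt_mul hpos hf0 hg0 hfi hgi hf1 hg1 hsq hsqrt
    set δ := γ ^ 2 * (R : ℝ) ^ (3 * d) * V ^ 2 with hδ
    have hδ0 : 0 ≤ δ := by positivity
    have h2 : (∫ x, (f x - g x) ^ 2 ∂(rho d)) / (8 * (V⁻¹ / 2)) ≤ δ := by
      rw [div_le_iff₀ (by positivity)]
      refine hsqint.trans (le_of_eq ?_)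
      rw [hδ]
      field_simp
      ring
    rcases Nat.eq_zero_or_pos n with rfl | hn0
    · norm_num
    have hn1 : (1 : ℝ) ≤ n := by exact_mod_cast hn0
    have hδ1 : δ ≤ 1 / 2 := by nlinarith
    have h3 := one_add_mul_le_pow (a := -δ) (by linarith) n
    calc (1 / 2 : ℝ) ≤ 1 + n * -δ := by linarith
      _ ≤ (1 + -δ) ^ n := h3
      _ ≤ _ := pow_le_pow_left₀ (by linarith) (by linarith) n
  refine le_localRisk_add_localRisk he (measurableSet_cell τ) fhat
    (measurable_multiDeriv_packetDensity _ _ _ _) (measurable_multiDeriv_packetDensity _ _ _ _)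
    hfi hgi hfc.measurable hgc.measurable (fun x => hpos.le.trans (hf0 x))
    (fun x => hpos.le.trans (hg0 x)) hf1 hg1 hsqrt haff (by positivity) fun θ hθ => ?_
  exact (le_multiDeriv_sub_multiDeriv m V⁻¹ hγ hR hd hτ hne hθ).trans (le_abs_self _)

/-! ### Membership in the Besov ball -/

namespace NeedletSystem

variable (N : NeedletSystem d)

lemma sum_lam_mul_expChar (j : ℕ) {l l' : Fin d → ℤ} (hl : freqNorm l ≤ N.B ^ (j + 1))
    (hl' : freqNorm l' ≤ N.B ^ (j + 1)) :
    ∑ k, (N.lam j k : ℂ) * (expChar l (N.ξ j k) * conj (expChar l' (N.ξ j k))) =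
      if l = l' then (((2 * Real.pi) ^ d : ℝ) : ℂ) else 0 := by
  have h := N.cubature j l l' hl hl'
  simp only [fourierS_eq, map_mul, Complex.conj_ofReal] at h
  set a : ℂ := (((2 * Real.pi) ^ (-(d : ℝ) / 2) : ℝ) : ℂ) with ha
  have ha0 : a * a ≠ 0 := by
    have : (2 * Real.pi) ^ (-(d : ℝ) / 2) ≠ 0 := (Real.rpow_pos_of_pos Real.two_pi_pos _).ne'
    exact mul_ne_zero (Complex.ofReal_ne_zero.mpr this) (Complex.ofReal_ne_zero.mpr this)
  rw [← integral_expChar_mul_conj]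
  refine mul_left_cancel₀ ha0 ?_
  rw [Finset.mul_sum, ← integral_const_mul]
  refine Eq.trans (Finset.sum_congr rfl fun k _ => ?_) (h.trans ?_)
  · ring
  · congr 1
    funext θ
    ring

lemma sum_lam (j : ℕ) : ∑ k, N.lam j k = (2 * Real.pi) ^ d := by
  have h0 : freqNorm (0 : Fin d → ℤ) ≤ N.B ^ (j + 1) := by
    have : freqNorm (0 : Fin d → ℤ) = 0 := by simp [freqNorm]
    rw [this]
    exact (pow_pos N.B_pos _).le
  have h := N.sum_lam_mul_expChar j h0 h0
  simp only [expChar_zero, map_one, mul_one, if_true] at h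
  exact_mod_cast h

lemma sum_lam_mul_sq_norm_blockSum (j : ℕ)
    (h : ∀ a : Fin d → Fin R, freqNorm (blockFreq R a) ≤ N.B ^ (j + 1)) (u : Fin d → ℝ) :
    ∑ k, N.lam j k * ‖blockSum R (N.ξ j k + u)‖ ^ 2 = (2 * Real.pi) ^ d * (R : ℝ) ^ d := by
  simp only [blockSum_add]
  rw [sum_sq_norm_trigSum (L := blockFreq R) _ (N.lam j) (N.ξ j) ((2 * Real.pi) ^ d),
    sum_sq_norm_expChar_block]
  intro a a'
  rw [N.sum_lam_mul_expChar j (h a) (h a')]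
  simp only [blockFreq_injective.eq_iff]

/-- Perturbations of the uniform density by packets of arbitrary bounded weights, or by a single
packet, of the right amplitude lie in the Besov ball. -/
lemma exists_packetDensity_mem (hd : 0 < d) (m : Fin d → ℕ) {s : ℝ} (hs : 0 < s) {r : ℝ≥0∞}
    (hr : 1 ≤ r) (q : ℝ≥0∞) {G : ℝ} (hG : 0 < G) : ∃ a : ℝ, 0 < a ∧
      a ≤ ((2 * Real.pi) ^ d)⁻¹ / 2 ∧ ∀ R : ℕ, 0 < R → ∀ γ : ℝ, 0 ≤ γ →
      γ * (R : ℝ) ^ (2 * d) ≤ ((2 * Real.pi) ^ d)⁻¹ / 2 →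
      ∀ ε : (Fin d → Fin R) → ℝ, (∀ τ, |ε τ| ≤ 1) →
      ((γ * (R : ℝ) ^ (2 * d) ≤ a * (R : ℝ) ^ (-(s + order m)) →
          packetDensity R (order m) γ ε ∈ N.densityBall m s r q G) ∧
        (∀ τ₀, (∀ τ, τ ≠ τ₀ → ε τ = 0) →
          γ * (R : ℝ) ^ (2 * d) ≤ a * (R : ℝ) ^ (-(s + order m - d * (r⁻¹).toReal)) →
          packetDensity R (order m) γ ε ∈ N.densityBall m s r q G)) := by
  have ht : 0 ≤ s + order m := by positivity
  obtain ⟨C, hC, hbes⟩ := N.exists_besovNorm_le hd ht hr q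
  set V : ℝ := (2 * Real.pi) ^ d with hV
  have hV0 : 0 < V := by have := Real.pi_pos; positivity
  set ϱ := (r⁻¹).toReal with hϱ
  refine ⟨min (V⁻¹ / 2) (G / (C * V ^ ϱ)), by positivity, min_le_left _ _, ?_⟩
  intro R hR γ hγ hA ε hε
  set a := min (V⁻¹ / 2) (G / (C * V ^ ϱ)) with ha
  have hR' : (0 : ℝ) < R := by exact_mod_cast hR
  have haG : C * (a * V ^ ϱ) ≤ G := by
    calc C * (a * V ^ ϱ) ≤ C * (G / (C * V ^ ϱ) * V ^ ϱ) := by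
          gcongr
          exact min_le_right _ _
      _ = G := by field_simp
  have hmem : ∀ W : ℝ, 0 ≤ W →
      (∀ j (ab : (Fin d → Fin R) × (Fin d → Fin R)), freqNorm (pairFreq R ab) ≤ N.B ^ (j + 1) → ∀ u,
        ∑ k, N.lam j k * ‖trigSum (pairFreq R) (packetCoeff R (order m) γ ε) (N.ξ j k + u)‖ ≤
          γ * (R : ℝ) ^ (2 * d) * W) →
      (R : ℝ) ^ (s + order m) * (γ * (R : ℝ) ^ (2 * d)) * W ^ ϱ ≤ a * V ^ ϱ →
      packetDensity R (order m) γ ε ∈ N.densityBall m s r q G := by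
    intro W hW hsamp hle
    refine ⟨isPeriodic_packetDensity _ _ _, contDiff_packetDensity _ _ _, fun θ => ?_,
      integral_packetDensity hd hR _ _ _, ?_⟩
    · exact le_trans (by positivity) (le_packetDensity _ hγ hA hε θ)
    · refine (hbes R hR' _ (pairFreq R) (packetCoeff R (order m) γ ε) V⁻¹ (γ * (R : ℝ) ^ (2 * d))
        W (by positivity) hW (two_mul_le_freqNorm_pairFreq hd) (freqNorm_pairFreq_le hd)
        (norm_trigSum_packetCoeff_le _ hγ hε) hsamp).trans ?_
      exact ENNReal.ofReal_le_ofReal ((mul_le_mul_of_nonneg_left hle hC.le).trans haG)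
  refine ⟨fun h => hmem V hV0.le (fun j _ _ u => ?_) ?_, fun τ₀ hτ₀ h =>
    hmem (V * ((R : ℝ) ^ d)⁻¹) (by positivity) (fun j ab hab u => ?_) ?_⟩
  · calc _ ≤ ∑ k, N.lam j k * (γ * (R : ℝ) ^ (2 * d)) :=
          Finset.sum_le_sum fun k _ => mul_le_mul_of_nonneg_left
            (norm_trigSum_packetCoeff_le _ hγ hε _) (N.lam_pos j k).le
      _ = _ := by rw [← Finset.sum_mul, N.sum_lam, mul_comm]
  · calc _ ≤ (R : ℝ) ^ (s + order m) * (a * (R : ℝ) ^ (-(s + order m))) * V ^ ϱ := by gcongr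
      _ = ((R : ℝ) ^ (s + order m) * (R : ℝ) ^ (-(s + order m))) * (a * V ^ ϱ) := by ring
      _ = _ := by rw [← Real.rpow_add hR', add_neg_cancel, Real.rpow_zero, one_mul]
  · calc _ ≤ ∑ k, γ * (N.lam j k * ‖blockSum R (N.ξ j k + (u - gridPoint R τ₀))‖ ^ 2) := by
          refine Finset.sum_le_sum fun k _ => ?_
          rw [mul_left_comm]
          refine mul_le_mul_of_nonneg_left
            ((norm_trigSum_packetCoeff_le_sum _ hγ ε _).trans ?_) (N.lam_pos j k).le
          rw [Finset.sum_eq_single τ₀ (fun τ _ hτ => by simp [hτ₀ τ hτ]) (by simp),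
            add_sub_assoc]
          exact mul_le_mul_of_nonneg_left (mul_le_of_le_one_left (sq_nonneg _) (hε τ₀)) hγ
      _ = γ * (V * (R : ℝ) ^ d) := by
          rw [← Finset.mul_sum, N.sum_lam_mul_sq_norm_blockSum j
            fun b => (freqNorm_blockFreq_le b ab).trans hab]
      _ = _ := by
          rw [two_mul, pow_add]
          field_simp
  · have h1 : (V * ((R : ℝ) ^ d)⁻¹) ^ ϱ = V ^ ϱ * (R : ℝ) ^ (-(d * ϱ)) := by
      rw [Real.mul_rpow hV0.le (by positivity), ← Real.rpow_natCast, ← Real.rpow_neg hR'.le,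
        ← Real.rpow_mul hR'.le, neg_mul]
    calc _ ≤ (R : ℝ) ^ (s + order m) * (a * (R : ℝ) ^ (-(s + order m - d * ϱ))) *
            (V ^ ϱ * (R : ℝ) ^ (-(d * ϱ))) := by
          rw [h1]
          gcongr
      _ = ((R : ℝ) ^ (s + order m) * (R : ℝ) ^ (-(s + order m - d * ϱ)) *
            (R : ℝ) ^ (-(d * ϱ))) * (a * V ^ ϱ) := by ring
      _ = _ := by
          rw [← Real.rpow_add hR', ← Real.rpow_add hR']
          ring_nf
          simp

end NeedletSystem

end

section

variable {d : ℕ}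

/-! ### Lower bounds for the maximal risk -/

lemma exists_grid_size {E e : ℝ} (hE : 0 < E) (he : 0 ≤ e) {n : ℕ} (hn : 1 ≤ n) :
    ∃ R : ℕ, 0 < R ∧ (n : ℝ) ≤ (R : ℝ) ^ E ∧
      2 ^ (-e) * (n : ℝ) ^ (-(e / E)) ≤ (R : ℝ) ^ (-e) := by
  have hn' : (1 : ℝ) ≤ n := by exact_mod_cast hn
  have hn0 : (0 : ℝ) < n := by linarith
  set y := (n : ℝ) ^ (1 / E) with hy
  have hy1 : 1 ≤ y := Real.one_le_rpow hn' (by positivity)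
  have hR : 0 < ⌈y⌉₊ := Nat.ceil_pos.mpr (by linarith)
  refine ⟨⌈y⌉₊, hR, ?_, ?_⟩
  · calc (n : ℝ) = y ^ E := by
          rw [hy, ← Real.rpow_mul hn0.le, one_div_mul_cancel hE.ne', Real.rpow_one]
      _ ≤ _ := Real.rpow_le_rpow (by linarith) (Nat.le_ceil y) hE.le
  · have h1 : ((⌈y⌉₊ : ℕ) : ℝ) ≤ 2 * y := by
      have := Nat.ceil_lt_add_one (by linarith : (0 : ℝ) ≤ y)
      linarith
    calc 2 ^ (-e) * (n : ℝ) ^ (-(e / E)) = (2 * y) ^ (-e) := by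
          rw [Real.mul_rpow two_pos.le (by linarith), hy, ← Real.rpow_mul hn0.le]
          congr 2
          ring
      _ ≤ _ := Real.rpow_le_rpow_of_nonpos (by exact_mod_cast hR) h1 (by linarith)

lemma ofReal_le_of_two_mul {y : ℝ} {X : ℝ≥0∞} (h : ENNReal.ofReal (2 * y) ≤ X + X) :
    ENNReal.ofReal y ≤ X := by
  rw [ENNReal.ofReal_mul two_pos.le, ENNReal.ofReal_ofNat, ← two_mul] at h
  exact (ENNReal.mul_le_mul_iff_right two_ne_zero ENNReal.ofNat_ne_top).mp h

/-- With `n ≤ R ^ (2σ + d)`, packets of amplitude `a R ^ (-σ)` cannot be detected from `n`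
observations. -/
lemma amplitude_conditions {R n : ℕ} (hR : 0 < R) {a σ : ℝ} (ha : 0 < a)
    (haV : a ≤ ((2 * Real.pi) ^ d)⁻¹ / 2) (hσ : 0 ≤ σ)
    (hn : (n : ℝ) ≤ (R : ℝ) ^ (2 * σ + d)) : ∃ γ : ℝ, 0 ≤ γ ∧
      γ * (R : ℝ) ^ (2 * d) = a * (R : ℝ) ^ (-σ) ∧
      γ * (R : ℝ) ^ (2 * d) ≤ ((2 * Real.pi) ^ d)⁻¹ / 2 ∧
      n * (γ ^ 2 * (R : ℝ) ^ (3 * d) * ((2 * Real.pi) ^ d) ^ 2) ≤ 1 / 2 := by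
  have hR' : (0 : ℝ) < R := by exact_mod_cast hR
  have hR1 : (1 : ℝ) ≤ R := by exact_mod_cast hR
  set V : ℝ := (2 * Real.pi) ^ d with hV
  have hV0 : 0 < V := by have := Real.pi_pos; positivity
  have h1 : a * (R : ℝ) ^ (-σ) / (R : ℝ) ^ (2 * d) * (R : ℝ) ^ (2 * d) = a * (R : ℝ) ^ (-σ) := by
    field_simp
  refine ⟨a * (R : ℝ) ^ (-σ) / (R : ℝ) ^ (2 * d), by positivity, h1, ?_, ?_⟩
  · rw [h1]
    have : (R : ℝ) ^ (-σ) ≤ 1 := Real.rpow_le_one_of_one_le_of_nonpos hR1 (by linarith)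
    nlinarith
  · have h2 : (a * (R : ℝ) ^ (-σ) / (R : ℝ) ^ (2 * d)) ^ 2 * (R : ℝ) ^ (3 * d) =
        a ^ 2 * ((R : ℝ) ^ (2 * σ + d))⁻¹ := by
      have h3 : (R : ℝ) ^ (2 * σ + d) = ((R : ℝ) ^ σ) ^ 2 * (R : ℝ) ^ d := by
        rw [Real.rpow_add hR', Real.rpow_natCast, ← Real.rpow_natCast ((R : ℝ) ^ σ),
          ← Real.rpow_mul hR'.le]
        congr 2
        push_cast
        ring
      have hRσ : 0 < (R : ℝ) ^ σ := Real.rpow_pos_of_pos hR' _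
      rw [h3, Real.rpow_neg hR'.le, show 3 * d = d + d + d by ring, two_mul]
      simp only [pow_add]
      field_simp
    have h4 : a * V ≤ 1 / 2 := by
      calc a * V ≤ V⁻¹ / 2 * V := by gcongr
        _ = 1 / 2 := by field_simp
    have h5 : (n : ℝ) * ((R : ℝ) ^ (2 * σ + d))⁻¹ ≤ 1 := by
      rw [← div_eq_mul_inv]
      exact div_le_one_of_le₀ hn (by positivity)
    calc _ = ((n : ℝ) * ((R : ℝ) ^ (2 * σ + d))⁻¹) * (a * V) ^ 2 := by
          rw [h2]
          ring
      _ ≤ 1 * (1 / 2) ^ 2 := by gcongr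
      _ ≤ 1 / 2 := by norm_num

namespace NeedletSystem

variable (N : NeedletSystem d)

/-- Two densities in the Besov ball that differ by a single packet and cannot be told apart from
`n` observations. -/
lemma exists_pair (hd : 0 < d) (m : Fin d → ℕ) {s : ℝ} {r : ℝ≥0∞} (hr : 1 ≤ r)
    (hs : (d : ℝ) * (r⁻¹).toReal < s) (q : ℝ≥0∞) {G : ℝ} (hG : 0 < G) :
    ∃ a : ℝ, 0 < a ∧ ∀ (R n : ℕ), 0 < R →
      (n : ℝ) ≤ (R : ℝ) ^ (2 * (s + order m - d * (r⁻¹).toReal) + d) →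
      ∀ (fhat : Estimator d n) (e : ℝ), 1 ≤ e →
      ∃ f ∈ N.densityBall m s r q G, ∃ g ∈ N.densityBall m s r q G, ∃ S : Set (Fin d → ℝ),
        MeasurableSet S ∧ Measurable (multiDeriv m f) ∧ Measurable (multiDeriv m g) ∧
        rho d S = ENNReal.ofReal ((1 / (4 * d * R)) ^ d) ∧
        ENNReal.ofReal (2 ^ (1 - e) / 8 * (a * (R : ℝ) ^ (-(s - d * (r⁻¹).toReal))) ^ e) *
          rho d S ≤
          localRisk e S fhat f (multiDeriv m f) + localRisk e S fhat g (multiDeriv m g) := by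
  classical
  have hϱ : 0 ≤ (r⁻¹).toReal := ENNReal.toReal_nonneg
  have hs0 : 0 < s := lt_of_le_of_lt (by positivity) hs
  obtain ⟨a, ha, haV, hball⟩ := N.exists_packetDensity_mem hd m hs0 hr q hG
  refine ⟨a, ha, fun R n hR hn fhat e he => ?_⟩
  have hR' : (0 : ℝ) < R := by exact_mod_cast hR
  have hM : (0 : ℝ) ≤ order m := Nat.cast_nonneg _
  obtain ⟨γ, hγ, hγR, hA, hnγ⟩ :=
    amplitude_conditions (d := d) hR ha haV (by linarith) hn
  let τ₀ : Fin d → Fin R := fun _ => ⟨0, hR⟩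
  have hsingle : ∀ x : ℝ, |x| ≤ 1 → ∀ τ, |(Pi.single τ₀ x : (Fin d → Fin R) → ℝ) τ| ≤ 1 := by
    intro x hx τ
    rcases eq_or_ne τ τ₀ with rfl | h
    · rwa [Pi.single_eq_same]
    · rw [Pi.single_eq_of_ne h, abs_zero]
      exact zero_le_one
  have h1 := hsingle 1 (by simp)
  have h2 := hsingle (-1) (by simp)
  refine ⟨packetDensity R (order m) γ (Pi.single τ₀ 1),
    ((hball R hR γ hγ hA _ h1).2 τ₀ (fun τ hτ => Pi.single_eq_of_ne hτ _) hγR.le),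
    packetDensity R (order m) γ (Pi.single τ₀ (-1)),
    ((hball R hR γ hγ hA _ h2).2 τ₀ (fun τ hτ => Pi.single_eq_of_ne hτ _) hγR.le),
    cell d R τ₀, measurableSet_cell _, measurable_multiDeriv_packetDensity _ _ _ _,
    measurable_multiDeriv_packetDensity _ _ _ _, rho_cell hd hR τ₀, ?_⟩
  have key := le_localRisk_packetDensity hd hR m hγ hA hnγ h1 h2 (τ := τ₀)
    (by rw [Pi.single_eq_same, Pi.single_eq_same]; norm_num)
    (fun σ hσ => by rw [Pi.single_eq_of_ne hσ, Pi.single_eq_of_ne hσ]) fhat he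
  have hval : γ * (R : ℝ) ^ (2 * d) * (R : ℝ) ^ order m =
      a * (R : ℝ) ^ (-(s - d * (r⁻¹).toReal)) := by
    rw [hγR, mul_assoc, ← Real.rpow_natCast, ← Real.rpow_add hR']
    congr 2
    ring
  rwa [hval] at key

/-- The rate of a single packet, for `p < ∞`. -/
lemma exists_le_iSup_risk_single (hd : 0 < d) (m : Fin d → ℕ) {s : ℝ} {r : ℝ≥0∞} (hr : 1 ≤ r)
    (hs : (d : ℝ) * (r⁻¹).toReal < s) (q : ℝ≥0∞) {G : ℝ} (hG : 0 < G) {p : ℝ≥0∞} (hp : 1 ≤ p)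
    (hp' : p ≠ ⊤) : ∃ c : ℝ, 0 < c ∧ ∀ n : ℕ, 1 ≤ n → ∀ fhat : Estimator d n,
      ENNReal.ofReal (c * (n : ℝ) ^ (-((p.toReal * (s - d * (r⁻¹).toReal) + d) /
        (2 * (s + order m - d * (r⁻¹).toReal) + d)))) ≤
      ⨆ f ∈ N.densityBall m s r q G, risk m p fhat f := by
  obtain ⟨a, ha, hpair⟩ := N.exists_pair hd m hr hs q hG
  have hd' : (0 : ℝ) < d := by exact_mod_cast hd
  have he : 1 ≤ p.toReal := by
    rw [← ENNReal.toReal_one]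
    exact ENNReal.toReal_mono hp' hp
  set e := p.toReal with he_def
  set w := e * (s - d * (r⁻¹).toReal) + d with hw
  have hM : (0 : ℝ) ≤ order m := Nat.cast_nonneg _
  have hw0 : 0 ≤ w := by nlinarith
  set C := 2 ^ (1 - e) / 8 * a ^ e * (1 / (4 * d)) ^ d with hC
  have hC0 : 0 < C := by positivity
  refine ⟨C * 2 ^ (-w) / 2, by positivity, fun n hn fhat => ?_⟩
  obtain ⟨R, hR, hnR, hrate⟩ := exists_grid_size
    (E := 2 * (s + order m - d * (r⁻¹).toReal) + d) (by linarith) hw0 hn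
  have hR' : (0 : ℝ) < R := by exact_mod_cast hR
  obtain ⟨f, hf, g, hg, S, hS, hDf, hDg, hvol, hle⟩ := hpair R n hR hnR fhat e he
  have hrisk : ∀ h ∈ N.densityBall m s r q G, Measurable (multiDeriv m h) →
      localRisk e S fhat h (multiDeriv m h) ≤
        ⨆ f ∈ N.densityBall m s r q G, risk m p fhat f := by
    intro h hh hm
    have := sum_localRisk_le_risk {()} (S := fun _ => S) (by simpa using hS) (by simp) m hp hp'
      fhat hm
    rw [Finset.sum_singleton] at this
    exact this.trans (le_iSup₂ (f := fun f _ => risk m p fhat f) h hh)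
  refine ofReal_le_of_two_mul (le_trans ?_ (hle.trans (add_le_add (hrisk f hf hDf)
    (hrisk g hg hDg))))
  rw [hvol, ← ENNReal.ofReal_mul (by positivity)]
  refine ENNReal.ofReal_le_ofReal ?_
  have h1 : 2 ^ (1 - e) / 8 * (a * (R : ℝ) ^ (-(s - d * (r⁻¹).toReal))) ^ e *
      (1 / (4 * d * R)) ^ d = C * (R : ℝ) ^ (-w) := by
    have h2 : (R : ℝ) ^ (-w) = ((R : ℝ) ^ (-(s - d * (r⁻¹).toReal))) ^ e * ((R : ℝ) ^ d)⁻¹ := by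
      rw [← Real.rpow_mul hR'.le, ← Real.rpow_natCast (R : ℝ) d, ← Real.rpow_neg hR'.le,
        ← Real.rpow_add hR', hw]
      congr 1
      ring
    rw [h2, hC, Real.mul_rpow ha.le (by positivity), one_div, one_div, mul_inv, mul_pow,
      inv_pow (R : ℝ)]
    ring
  rw [h1]
  calc _ = C * (2 ^ (-w) * (n : ℝ) ^ (-(w / (2 * (s + order m - d * (r⁻¹).toReal) + d)))) := by
        ring
    _ ≤ _ := by gcongr

/-- The rate of a single packet, for `p = ∞`. -/
lemma exists_le_iSup_risk_top (hd : 0 < d) (m : Fin d → ℕ) {s : ℝ} {r : ℝ≥0∞} (hr : 1 ≤ r)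
    (hs : (d : ℝ) * (r⁻¹).toReal < s) (q : ℝ≥0∞) {G : ℝ} (hG : 0 < G) :
    ∃ c : ℝ, 0 < c ∧ ∀ n : ℕ, 1 ≤ n → ∀ fhat : Estimator d n,
      ENNReal.ofReal (c * (n : ℝ) ^ (-((s - d * (r⁻¹).toReal) /
        (2 * (s + order m - d * (r⁻¹).toReal) + d)))) ≤
      ⨆ f ∈ N.densityBall m s r q G, risk m ⊤ fhat f := by
  obtain ⟨a, ha, hpair⟩ := N.exists_pair hd m hr hs q hG
  have hd' : (0 : ℝ) < d := by exact_mod_cast hd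
  set w := s - d * (r⁻¹).toReal with hw
  have hM : (0 : ℝ) ≤ order m := Nat.cast_nonneg _
  have hw0 : 0 ≤ w := by linarith
  refine ⟨1 / 8 * a * 2 ^ (-w) / 2, by positivity, fun n hn fhat => ?_⟩
  obtain ⟨R, hR, hnR, hrate⟩ := exists_grid_size
    (E := 2 * (s + order m - d * (r⁻¹).toReal) + d) (by linarith) hw0 hn
  have hR' : (0 : ℝ) < R := by exact_mod_cast hR
  obtain ⟨f, hf, g, hg, S, hS, hDf, hDg, hvol, hle⟩ := hpair R n hR hnR fhat 1 le_rfl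
  set X := ⨆ f ∈ N.densityBall m s r q G, risk m ⊤ fhat f with hX
  have hrisk : ∀ h ∈ N.densityBall m s r q G,
      localRisk 1 S fhat h (multiDeriv m h) ≤ X * rho d S := by
    intro h hh
    refine (localRisk_one_le_risk_top S m fhat h).trans ?_
    gcongr
    exact le_iSup₂ (f := fun f _ => risk m ⊤ fhat f) h hh
  have h1 := hle.trans (add_le_add (hrisk f hf) (hrisk g hg))
  rw [← add_mul] at h1
  have hS0 : rho d S ≠ 0 := by
    rw [hvol, Ne, ENNReal.ofReal_eq_zero, not_le]
    positivity
  have h2 := (ENNReal.mul_le_mul_iff_left hS0 (measure_ne_top _ _)).mp h1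
  refine ofReal_le_of_two_mul (le_trans (ENNReal.ofReal_le_ofReal ?_) h2)
  rw [Real.rpow_one, sub_self, Real.rpow_zero]
  calc _ = 1 / 8 * a *
        (2 ^ (-w) * (n : ℝ) ^ (-(w / (2 * (s + order m - d * (r⁻¹).toReal) + d)))) := by ring
    _ ≤ 1 / 8 * a * (R : ℝ) ^ (-w) := by gcongr
    _ = _ := by ring

/-- The sign vector of a vertex of the hypercube. -/
def signs {T : Type*} (v : T → Bool) : T → ℝ := fun τ => if v τ then 1 else -1

lemma abs_signs_le {T : Type*} (v : T → Bool) (τ : T) : |signs v τ| ≤ 1 := by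
  unfold signs
  split_ifs <;> simp

/-- **Assouad's averaging argument**: if along every edge of the hypercube in direction `τ` the two
losses `Φ τ` add up to at least `κ`, some vertex has total loss at least `|T| κ / 2`. -/
lemma card_mul_le_of_edges {T : Type*} [Fintype T] [DecidableEq T] {Φ : T → (T → Bool) → ℝ≥0∞}
    {κ X : ℝ≥0∞}
    (hedge : ∀ τ v, v τ = true → κ ≤ Φ τ v + Φ τ (Function.update v τ false))
    (hX : ∀ v, ∑ τ, Φ τ v ≤ X) : (Fintype.card T : ℝ≥0∞) * κ ≤ X + X := by
  have hflip : ∀ τ, ∑ v : T → Bool, Φ τ (Function.update v τ (!v τ)) = ∑ v, Φ τ v := by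
    intro τ
    have hinv : Function.Involutive fun v : T → Bool => Function.update v τ (!v τ) := by
      intro v
      simp
    exact Equiv.sum_comp hinv.toPerm (fun v => Φ τ v)
  have hedge' : ∀ τ v, κ ≤ Φ τ v + Φ τ (Function.update v τ (!v τ)) := by
    intro τ v
    cases h : v τ
    · have := hedge τ (Function.update v τ true) (by simp)
      rw [Function.update_idem, ← h, Function.update_eq_self, add_comm] at this
      simpa using this
    · simpa using hedge τ v h
  have hsum : (Fintype.card (T → Bool) : ℝ≥0∞) * ((Fintype.card T : ℝ≥0∞) * κ) ≤
      (Fintype.card (T → Bool) : ℝ≥0∞) * (X + X) := by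
    calc _ = ∑ τ : T, ∑ _v : T → Bool, κ := by
          simp only [Finset.sum_const, Finset.card_univ, nsmul_eq_mul]
          ring
      _ ≤ ∑ τ : T, ∑ v : T → Bool, (Φ τ v + Φ τ (Function.update v τ (!v τ))) :=
          Finset.sum_le_sum fun τ _ => Finset.sum_le_sum fun v _ => hedge' τ v
      _ = ∑ v : T → Bool, ((∑ τ, Φ τ v) + ∑ τ, Φ τ v) := by
          simp only [Finset.sum_add_distrib, hflip]
          rw [Finset.sum_comm]
      _ ≤ ∑ _v : T → Bool, (X + X) := Finset.sum_le_sum fun v _ => add_le_add (hX v) (hX v)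
      _ = _ := by simp only [Finset.sum_const, Finset.card_univ, nsmul_eq_mul]
  exact (ENNReal.mul_le_mul_iff_right (by exact_mod_cast Fintype.card_ne_zero)
    (ENNReal.natCast_ne_top _)).mp hsum

/-- The rate of the hypercube of packets at all grid points, for `p < ∞`. -/
lemma exists_le_iSup_risk_cube (hd : 0 < d) (m : Fin d → ℕ) {s : ℝ} (hs : 0 < s) {r : ℝ≥0∞}
    (hr : 1 ≤ r) (q : ℝ≥0∞) {G : ℝ} (hG : 0 < G) {p : ℝ≥0∞} (hp : 1 ≤ p)
    (hp' : p ≠ ⊤) : ∃ c : ℝ, 0 < c ∧ ∀ n : ℕ, 1 ≤ n → ∀ fhat : Estimator d n,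
      ENNReal.ofReal (c * (n : ℝ) ^ (-(p.toReal * s / (2 * (s + order m) + d)))) ≤
      ⨆ f ∈ N.densityBall m s r q G, risk m p fhat f := by
  classical
  obtain ⟨a, ha, haV, hball⟩ := N.exists_packetDensity_mem hd m hs hr q hG
  have hd' : (0 : ℝ) < d := by exact_mod_cast hd
  have he : 1 ≤ p.toReal := by
    rw [← ENNReal.toReal_one]
    exact ENNReal.toReal_mono hp' hp
  set e := p.toReal with he_def
  have hM : (0 : ℝ) ≤ order m := Nat.cast_nonneg _
  have hw0 : 0 ≤ e * s := by positivity
  set C := 2 ^ (1 - e) / 8 * a ^ e * (1 / (4 * d)) ^ d with hC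
  have hC0 : 0 < C := by positivity
  refine ⟨C * 2 ^ (-(e * s)) / 2, by positivity, fun n hn fhat => ?_⟩
  obtain ⟨R, hR, hnR, hrate⟩ := exists_grid_size (E := 2 * (s + order m) + d) (by linarith) hw0 hn
  have hR' : (0 : ℝ) < R := by exact_mod_cast hR
  obtain ⟨γ, hγ, hγR, hA, hnγ⟩ :=
    amplitude_conditions (d := d) hR ha haV (by linarith) hnR
  set X := ⨆ f ∈ N.densityBall m s r q G, risk m p fhat f with hX
  have key := card_mul_le_of_edges (T := Fin d → Fin R) (X := X)
    (Φ := fun τ v => localRisk e (cell d R τ) fhat (packetDensity R (order m) γ (signs v))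
      (multiDeriv m (packetDensity R (order m) γ (signs v))))
    (κ := ENNReal.ofReal (2 ^ (1 - e) / 8 *
      (γ * (R : ℝ) ^ (2 * d) * (R : ℝ) ^ order m) ^ e) * ENNReal.ofReal ((1 / (4 * d * R)) ^ d))
    (by
      intro τ v hv
      rw [← rho_cell hd hR τ]
      refine le_localRisk_packetDensity hd hR m hγ hA hnγ (abs_signs_le _) (abs_signs_le _)
        ?_ (fun σ hσ => ?_) fhat he
      · simp only [signs, hv, if_true, Function.update_self]
        norm_num
      · simp only [signs, Function.update_of_ne hσ])
    (by
      intro v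
      refine (sum_localRisk_le_risk Finset.univ (fun τ _ => measurableSet_cell τ)
        (fun τ _ τ' _ h => disjoint_cell hd hR h) m hp hp' fhat
        (measurable_multiDeriv_packetDensity m _ _ _)).trans ?_
      exact le_iSup₂ (f := fun f _ => risk m p fhat f) _
        ((hball R hR γ hγ hA _ (abs_signs_le v)).1 hγR.le))
  refine ofReal_le_of_two_mul (le_trans ?_ key)
  rw [← ENNReal.ofReal_natCast, ← ENNReal.ofReal_mul (by positivity),
    ← ENNReal.ofReal_mul (by positivity)]
  refine ENNReal.ofReal_le_ofReal ?_
  have h1 : γ * (R : ℝ) ^ (2 * d) * (R : ℝ) ^ order m = a * (R : ℝ) ^ (-s) := by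
    rw [hγR, mul_assoc, ← Real.rpow_natCast, ← Real.rpow_add hR']
    congr 2
    ring
  have h2 : ((Fintype.card (Fin d → Fin R) : ℕ) : ℝ) * (2 ^ (1 - e) / 8 *
      (γ * (R : ℝ) ^ (2 * d) * (R : ℝ) ^ order m) ^ e * (1 / (4 * d * R)) ^ d) =
      C * (R : ℝ) ^ (-(e * s)) := by
    rw [h1, Real.mul_rpow ha.le (by positivity), ← Real.rpow_mul hR'.le, hC, Fintype.card_fun,
      Fintype.card_fin, Fintype.card_fin, neg_mul, mul_comm s e, one_div, one_div, mul_inv,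
      mul_pow, inv_pow (R : ℝ)]
    push_cast
    field_simp
  rw [h2]
  calc _ = C * (2 ^ (-(e * s)) * (n : ℝ) ^ (-(e * s / (2 * (s + order m) + d)))) := by ring
    _ ≤ _ := by gcongr

end NeedletSystem

end

end TorusNeedlet

end

theorem theorem3p2 {d : ℕ} (hd : 0 < d) (N : TorusNeedlet.NeedletSystem d) (m : Fin d → ℕ)
    (s : ℝ) (r q p : ℝ≥0∞) (hr : 1 ≤ r) (hq : 0 < q) (hp : 1 ≤ p)
    (hs : (d : ℝ) * (r⁻¹).toReal < s) (G : ℝ) (hG : 0 < G) :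
    ∃ c : ℝ, 0 < c ∧ ∀ n : ℕ, 1 ≤ n → ∀ fhat : TorusNeedlet.Estimator d n,
      ENNReal.ofReal
          (c * (n : ℝ) ^ (-TorusNeedlet.rateExponent d s (TorusNeedlet.order m) p r)) ≤
        ⨆ f ∈ N.densityBall m s r q G, TorusNeedlet.risk m p fhat f := by
  have hs0 : 0 < s := lt_of_le_of_lt (by positivity) hs
  unfold TorusNeedlet.rateExponent
  split_ifs with hp' hzone
  · subst hp'
    convert! N.exists_le_iSup_risk_top hd m hr hs q hG using 12
    ring
  · exact N.exists_le_iSup_risk_cube hd m hs0 hr q hG hp hp'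
  · have hp0 : p.toReal ≠ 0 := (ENNReal.toReal_pos (zero_lt_one.trans_le hp).ne' hp').ne'
    convert! N.exists_le_iSup_risk_single hd m hr hs q hG hp hp' using 12
    · field_simp
      ring
    · ring
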